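/- Let $d\ge 1$ be an integer and $\alpha\in(0,2]$. A probability law $\mu$ on $\mathbb{R}^d$ is called spherically symmetric if it is invariant under all linear isometries of $\mathbb{R}^d$, and $\alpha$-stable if it is not a point mass and, for independent $X,X'$ with law $\mu$ and all $a,b>0$, there is $v\in\mathbb{R}^d$ such that $aX+bX'$ has the same law as $(a^\alpha+b^\alpha)^{1/\alpha}X+v$. (i) A probability law on $\mathbb{R}^d$ is spherically symmetric and $\alpha$-stable if and only if its characteristic function is $\xi\mapsto\exp(-(\sigma|\xi|)^\alpha)$ for some scale $\sigma>0$. (ii) If $\mu$ is normalized to $\sigma=1$, i.e. its characteristic function is $$f_{\alpha,d}(\xi)=\exp(-|\xi|^\alpha),\qquad \xi\in\mathbb{R}^d,$$ then $\mu$ has a continuous nonnegative density $\rho_{\alpha,d}$ with respect to Lebesgue measure, and for every $x\neq 0$ $$\rho_{\alpha,d}(x)=\pi^{-d/2}|x|^{-d}\,H^{1,1}_{1,2}\!\left[\left(\tfrac{|x|}{2}\right)^{\alpha}\,\middle|\,\begin{array}{l}(1,1)\\(d/2,\alpha/2),\ (1,\alpha/2)\end{array}\right].$$ Here $H^{1,1}_{1,2}$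 is the Fox $H$-function. Explicitly, for $z>0$, $$H^{1,1}_{1,2}\!\left[z\,\middle|\,\begin{array}{l}(1,1)\\(d/2,\alpha/2),\ (1,\alpha/2)\end{array}\right]=\frac{1}{2\pi i}\int_{\gamma-i\infty}^{\gamma+i\infty}\frac{\Gamma\!\left(\frac d2+\frac{\alpha s}{2}\right)\Gamma(-s)}{\Gamma\!\left(-\frac{\alpha s}{2}\right)}\,z^{-s}\,ds ,$$ where $\gamma\in(-d/\alpha,0)$ is arbitrary, so that the line $\operatorname{Re}s=\gamma$ separates the poles of $\Gamma(\frac d2+\frac{\alpha s}{2})$ from those of $\Gamma(-s)$; the integral converges absolutely and does not depend on $\gamma$. -/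

import Mathlib

open MeasureTheory ProbabilityTheory

noncomputable section

/-- The law `μ` on `E` is invariant under every linear isometry (in dimension one: `x ↦ -x`). -/
def SphericallySymmetric {E : Type*} [NormedAddCommGroup E] [InnerProductSpace ℝ E]
    [MeasurableSpace E] (μ : Measure E) : Prop :=
  ∀ U : E ≃ₗᵢ[ℝ] E, μ.map U = μ

/-- The law `μ` on `E` is stable of index `α`: it is not a point mass, and if `X, X'` are
independent with law `μ` and `a, b > 0`, then `a X + b X'` has the law of
`(a ^ α + b ^ α) ^ (1 / α) X + v` for some vector `v`. -/
def IsStableLaw {E : Type*} [NormedAddCommGroup E] [InnerProductSpace ℝ E]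
    [MeasurableSpace E] (α : ℝ) (μ : Measure E) : Prop :=
  (∀ v : E, μ ≠ Measure.dirac v) ∧
  ∀ a b : ℝ, 0 < a → 0 < b → ∃ v : E,
    (μ.prod μ).map (fun x : E × E => a • x.1 + b • x.2) =
      μ.map (fun x : E => ((a ^ α + b ^ α) ^ (1 / α)) • x + v)

/-- The quotient of products of Gamma functions in the Mellin–Barnes integral of
`H^{m,n}_{p,q}`. The upper parameters are the pairs `a i = (a_i, α_i)`, the lower ones the
pairs `b j = (b_j, β_j)`; indices start at `0`. (At a pole of a Gamma function in the
denominator the quotient is `0`, as it should be.) -/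
def foxKernel (m n : ℕ) {p q : ℕ} (a : Fin p → ℂ × ℝ) (b : Fin q → ℂ × ℝ) (s : ℂ) : ℂ :=
  ((∏ j with j.val < m, Complex.Gamma ((b j).1 + (b j).2 * s)) *
      ∏ i with i.val < n, Complex.Gamma (1 - (a i).1 - (a i).2 * s)) /
    ((∏ i with n ≤ i.val, Complex.Gamma ((a i).1 + (a i).2 * s)) *
      ∏ j with m ≤ j.val, Complex.Gamma (1 - (b j).1 - (b j).2 * s))

/-- `0 ≤ m ≤ q`, `0 ≤ n ≤ p`, and all `α_i` and `β_j` are positive. -/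
def FoxAdmissible (m n : ℕ) {p q : ℕ} (a : Fin p → ℂ × ℝ) (b : Fin q → ℂ × ℝ) : Prop :=
  m ≤ q ∧ n ≤ p ∧ (∀ i, 0 < (a i).2) ∧ ∀ j, 0 < (b j).2

/-- The vertical line `Re s = γ` leaves all poles of `Γ(b_j + β_j s)`, `j = 1, …, m`, to its
left and all poles of `Γ(1 - a_i - α_i s)`, `i = 1, …, n`, to its right. -/
def FoxSeparates (m n : ℕ) {p q : ℕ} (a : Fin p → ℂ × ℝ) (b : Fin q → ℂ × ℝ) (γ : ℝ) : Prop :=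
  (∀ j, j.val < m → ∀ l : ℕ, ((-(b j).1 - l) / (b j).2).re < γ) ∧
  (∀ i, i.val < n → ∀ k : ℕ, γ < ((1 - (a i).1 + k) / (a i).2).re)

/-- The integrand `𝓗(s) z ^ (-s)` at the point `s = γ + i t` of the contour. -/
def foxIntegrand (m n : ℕ) {p q : ℕ} (a : Fin p → ℂ × ℝ) (b : Fin q → ℂ × ℝ) (γ : ℝ) (z : ℂ)
    (t : ℝ) : ℂ :=
  foxKernel m n a b (γ + t * Complex.I) * z ^ (-(γ + t * Complex.I : ℂ))

/-- `HasFoxH m n a b z w`: the Fox function `H^{m,n}_{p,q}[z | a; b]`, with contour from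
`γ - i∞` to `γ + i∞`, is defined and equal to `w`. That is, some vertical line separates the
poles, and on every such line the integral converges absolutely and
`w = (1 / (2 π i)) ∫_{Re s = γ} 𝓗(s) z ^ (-s) ds`; here `ds = i dt`. -/
def HasFoxH (m n : ℕ) {p q : ℕ} (a : Fin p → ℂ × ℝ) (b : Fin q → ℂ × ℝ) (z w : ℂ) : Prop :=
  FoxAdmissible m n a b ∧ (∃ γ : ℝ, FoxSeparates m n a b γ) ∧
  ∀ γ : ℝ, FoxSeparates m n a b γ →
    Integrable (foxIntegrand m n a b γ z) ∧
    w = 1 / (2 * Real.pi * Complex.I) * ∫ t : ℝ, foxIntegrand m n a b γ z t * Complex.I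

end

/-! ### Characteristic functions of symmetric stable laws -/

section StableCharFun

open Complex
open scoped RealInnerProductSpace ComplexConjugate

/-! Everything passes through the characteristic function φ. For (i), symmetry makes φ real and
radial. Comparing the stability identity at ξ and -ξ removes the shift v, and what remains for the
radial profile, g(a) g(b) = g((a^α + b^α)^(1/α)), is Cauchy's equation in the variable u = t^α
(`exists_eq_exp_neg_mul_rpow`).

For (ii), φ is integrable and its Fourier transform is the density; positivity and integrability
come from Gaussian regularisation (`eq_withDensity_fourierDensity`). The H-function appears by
Mellin inversion of the radial profile of the density. Up to the area of the sphere, the Mellin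
transform at w is the moment ∫ ‖x‖^(w - n) dμ, with n the dimension. The Gamma integral writes this
power as a superposition of Gaussians; carrying each Gaussian to the Fourier side turns the moment
into a multiple of ∫ ‖ζ‖^(-w) φ(2πζ) dζ (`Gamma_mul_integral_norm_cpow`), which is again a Gamma
integral. Under w = n + αs the Gamma factors become the Fox kernel. Inversion needs absolute
convergence on vertical lines: Γ(-s) decays faster than any power there, while the quotient of the
other two factors grows at most polynomially (`integrable_stableKernel`). -/

theorem exists_linearIsometryEquiv_apply_eq {E : Type*} [NormedAddCommGroup E]
    [InnerProductSpace ℝ E] {x y : E} (h : ‖x‖ = ‖y‖) :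
    ∃ U : E ≃ₗᵢ[ℝ] E, U x = y :=
  ⟨_, Submodule.reflection_sub h⟩

variable {E : Type*} [NormedAddCommGroup E] [InnerProductSpace ℝ E] [MeasurableSpace E]

theorem charFun_map_linearIsometryEquiv [BorelSpace E] (μ : Measure E) (U : E ≃ₗᵢ[ℝ] E) (ξ : E) :
    charFun (μ.map U) ξ = charFun μ (U.symm ξ) := by
  rw [charFun_apply, charFun_apply, integral_map (by fun_prop) (by fun_prop)]
  simp [LinearIsometryEquiv.inner_map_eq_flip]

theorem SphericallySymmetric.charFun_apply_eq [BorelSpace E] {μ : Measure E}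
    (h : SphericallySymmetric μ) {x y : E} (hxy : ‖x‖ = ‖y‖) : charFun μ x = charFun μ y := by
  obtain ⟨U, rfl⟩ := exists_linearIsometryEquiv_apply_eq hxy
  have := charFun_map_linearIsometryEquiv μ U (U x)
  rw [h U] at this
  simpa using this.symm

theorem SphericallySymmetric.charFun_eq_ofReal_re [BorelSpace E] {μ : Measure E}
    (h : SphericallySymmetric μ) (x : E) : charFun μ x = ((charFun μ x).re : ℂ) := by
  have h1 : charFun μ (-x) = charFun μ x := h.charFun_apply_eq (norm_neg x)
  rw [charFun_neg] at h1
  exact (Complex.conj_eq_iff_re.1 h1).symm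

theorem sphericallySymmetric_of_charFun [BorelSpace E] [SecondCountableTopology E]
    [CompleteSpace E] {μ : Measure E} [IsFiniteMeasure μ]
    (h : ∀ x y, ‖x‖ = ‖y‖ → charFun μ x = charFun μ y) : SphericallySymmetric μ := by
  intro U
  refine Measure.ext_of_charFun (funext fun ξ => ?_)
  rw [charFun_map_linearIsometryEquiv]
  exact h _ _ (by simp)

theorem charFun_map_prod_smul_add_smul [BorelSpace E] [SecondCountableTopology E]
    (μ : Measure E) [SFinite μ] (a b : ℝ) (ξ : E) :
    charFun ((μ.prod μ).map (fun x : E × E => a • x.1 + b • x.2)) ξ =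
      charFun μ (a • ξ) * charFun μ (b • ξ) := by
  rw [charFun_apply, charFun_apply, charFun_apply, integral_map (by fun_prop) (by fun_prop),
    ← integral_prod_mul]
  congr with x
  rw [← Complex.exp_add]
  congr 1
  simp only [inner_add_left, inner_smul_left, inner_smul_right]
  simp
  ring

theorem charFun_map_smul_add_const [BorelSpace E] [SecondCountableTopology E]
    (μ : Measure E) (c : ℝ) (v ξ : E) :
    charFun (μ.map (fun x : E => c • x + v)) ξ = charFun μ (c • ξ) * cexp (⟪v, ξ⟫ * I) := by
  have : (fun x : E => c • x + v) = (· + v) ∘ (c • ·) := rfl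
  rw [this, ← Measure.map_map (by fun_prop) (by fun_prop), charFun_map_add_const,
    charFun_map_smul]

theorem charFun_tendsto_one [BorelSpace E] [SecondCountableTopology E] (μ : Measure E)
    [IsProbabilityMeasure μ] : Filter.Tendsto (charFun μ) (nhds 0) (nhds 1) := by
  have := (continuous_charFun (μ := μ)).tendsto 0
  simpa using this

/-- If the exponential of `i⟪v, ·⟫` is real wherever the characteristic function does not vanish,
then `v = 0`. -/
theorem eq_zero_of_forall_inner [BorelSpace E] [SecondCountableTopology E] {μ : Measure E}
    [IsProbabilityMeasure μ] {c : ℝ} {v : E}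
    (h : ∀ ξ, charFun μ (c • ξ) * cexp (⟪v, ξ⟫ * I) = charFun μ (c • ξ) * cexp (-⟪v, ξ⟫ * I)) :
    v = 0 := by
  -- On the ray ξ = t v with t small the characteristic function is near 1 and can be cancelled, so
  -- sin(t‖v‖²) vanishes near t = 0; its derivative there, ‖v‖², must then be 0.
  have hc : Filter.Tendsto (fun t : ℝ => charFun μ (c • (t • v))) (nhds 0) (nhds 1) := by
    refine (charFun_tendsto_one μ).comp ?_
    have : Continuous fun t : ℝ => c • (t • v) := by fun_prop
    simpa using this.tendsto 0
  have hne : ∀ᶠ t : ℝ in nhds 0, charFun μ (c • (t • v)) ≠ 0 :=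
    hc.eventually_ne one_ne_zero
  have hsin : ∀ᶠ t : ℝ in nhds 0, Real.sin (t * ‖v‖ ^ 2) = 0 := by
    filter_upwards [hne] with t ht
    have h1 := mul_left_cancel₀ ht (h (t • v))
    have h2 := congrArg Complex.im h1
    have h3 : (⟪v, t • v⟫ : ℝ) = t * ‖v‖ ^ 2 := by
      rw [inner_smul_right, real_inner_self_eq_norm_sq]
    rw [h3, ← Complex.ofReal_neg, Complex.exp_ofReal_mul_I_im, Complex.exp_ofReal_mul_I_im,
      Real.sin_neg] at h2
    linarith
  have hd : HasDerivAt (fun t : ℝ => Real.sin (t * ‖v‖ ^ 2)) (‖v‖ ^ 2) 0 := by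
    have := ((hasDerivAt_id (0 : ℝ)).mul_const (‖v‖ ^ 2)).sin
    simpa using this
  have h0 : HasDerivAt (fun t : ℝ => Real.sin (t * ‖v‖ ^ 2)) 0 0 :=
    (hasDerivAt_const (0 : ℝ) (0 : ℝ)).congr_of_eventuallyEq hsin
  have := hd.unique h0
  simpa using this

/-- A continuous function that is additive on `[0, ∞)` is linear there. -/
theorem exists_eq_mul_of_additive_nonneg {L : ℝ → ℝ} (hL : Continuous L)
    (hadd : ∀ u v, 0 ≤ u → 0 ≤ v → L (u + v) = L u + L v) :
    ∃ k : ℝ, ∀ u, 0 ≤ u → L u = k * u := by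
  have h0 : L 0 = 0 := by simpa using hadd 0 0 le_rfl le_rfl
  -- The odd extension of L, additive on all of ℝ; a continuous additive map is ℝ-linear.
  let M : ℝ →+ ℝ :=
    { toFun := fun u => L (max u 0) - L (max (-u) 0)
      map_zero' := by simp
      map_add' := by
        intro u v
        have e : max (u + v) 0 + (max (-u) 0 + max (-v) 0) =
            max (-(u + v)) 0 + (max u 0 + max v 0) := by
          have a1 := max_zero_sub_max_neg_zero_eq_self u
          have a2 := max_zero_sub_max_neg_zero_eq_self v
          have a3 := max_zero_sub_max_neg_zero_eq_self (u + v)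
          linarith
        have := congrArg L e
        rw [hadd _ _ (by positivity) (by positivity), hadd _ _ (by positivity) (by positivity),
          hadd _ _ (by positivity) (by positivity), hadd _ _ (by positivity) (by positivity)] at this
        linarith }
  have hM : Continuous M := by
    change Continuous fun u => L (max u 0) - L (max (-u) 0)
    fun_prop
  refine ⟨M 1, fun u hu => ?_⟩
  have h1 : M u = L u := by
    change L (max u 0) - L (max (-u) 0) = L u
    rw [max_eq_left hu, max_eq_right (by linarith), h0, sub_zero]
  have h2 := map_real_smul M hM u 1
  simp only [smul_eq_mul, mul_one] at h2
  rw [← h1, h2, mul_comm]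

/-- A continuous solution of `g (a t) g (b t) = g ((a ^ α + b ^ α) ^ (1 / α) t)` with `g 0 = 1`
is a stretched exponential. -/
theorem exists_eq_exp_neg_mul_rpow {α : ℝ} (hα : 0 < α) {g : ℝ → ℝ} (hg : Continuous g)
    (h0 : g 0 = 1)
    (hmul : ∀ a b, 0 < a → 0 < b → g a * g b = g ((a ^ α + b ^ α) ^ (1 / α))) :
    ∃ k : ℝ, ∀ t, 0 ≤ t → g t = Real.exp (k * t ^ α) := by
  -- In the variable u = t^α the equation reads h(u + v) = h(u) h(v) for u, v ≥ 0. The absolute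
  -- value makes h even and continuous on all of ℝ, so that its logarithm is too.
  let h : ℝ → ℝ := fun u => g (|u| ^ (1 / α))
  have hα' : 0 < 1 / α := by positivity
  have hc : Continuous h := hg.comp ((continuous_abs).rpow_const fun _ => Or.inr hα'.le)
  have hh0 : h 0 = 1 := by simp [h, h0, hα.ne']
  have hadd : ∀ u v, 0 ≤ u → 0 ≤ v → h (u + v) = h u * h v := by
    intro u v hu hv
    rcases hu.eq_or_lt with rfl | hu
    · simp [hh0]
    rcases hv.eq_or_lt with rfl | hv
    · simp [hh0]
    have := hmul (u ^ (1 / α)) (v ^ (1 / α)) (by positivity) (by positivity)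
    rw [← Real.rpow_mul hu.le, ← Real.rpow_mul hv.le, one_div_mul_cancel hα.ne', Real.rpow_one,
      Real.rpow_one] at this
    simp only [h, abs_of_pos hu, abs_of_pos hv, abs_of_pos (add_pos hu hv)]
    exact this.symm
  have hsq : ∀ u, 0 ≤ u → h u = h (u / 2) ^ 2 := by
    intro u hu
    rw [sq, ← hadd _ _ (by positivity) (by positivity), add_halves]
  -- A zero at u would propagate to u / 2^n for all n, contradicting h(0) = 1.
  have hne : ∀ u, 0 ≤ u → h u ≠ 0 := by
    intro u hu hz
    have hz' : ∀ n : ℕ, h (u / 2 ^ n) = 0 := by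
      intro n
      induction n with
      | zero => simpa using hz
      | succ n ih =>
        rw [hsq _ (by positivity), div_div, ← pow_succ] at ih
        exact pow_eq_zero_iff two_ne_zero |>.1 ih
    have ht : Filter.Tendsto (fun n : ℕ => u / 2 ^ n) Filter.atTop (nhds 0) :=
      tendsto_const_nhds.div_atTop (tendsto_pow_atTop_atTop_of_one_lt one_lt_two)
    have h1 := (hc.tendsto 0).comp ht
    have h2 : h ∘ (fun n : ℕ => u / 2 ^ n) = fun _ => 0 := funext hz'
    rw [h2, hh0] at h1
    exact zero_ne_one (tendsto_nhds_unique tendsto_const_nhds h1)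
  have heven : ∀ u, h u = h |u| := fun u => by simp [h]
  have hne' : ∀ u, h u ≠ 0 := fun u => by rw [heven]; exact hne _ (abs_nonneg u)
  have hpos : ∀ u, 0 ≤ u → 0 < h u := fun u hu => by
    rw [hsq u hu]
    have := hne' (u / 2)
    positivity
  obtain ⟨k, hk⟩ := exists_eq_mul_of_additive_nonneg (hc.log hne') (fun u v hu hv => by
    rw [hadd u v hu hv, Real.log_mul (hne' _) (hne' _)])
  refine ⟨k, fun t ht => ?_⟩
  have htα : 0 ≤ t ^ α := by positivity
  have e : h (t ^ α) = g t := by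
    simp only [h, abs_of_nonneg htα]
    rw [← Real.rpow_mul ht, mul_one_div_cancel hα.ne', Real.rpow_one]
  rw [← hk _ htα, Real.exp_log (hpos _ htα), e]

theorem SphericallySymmetric.exists_charFun_eq [BorelSpace E] [SecondCountableTopology E]
    [CompleteSpace E] [Nontrivial E] {α : ℝ} (hα : 0 < α) {μ : Measure E} [IsProbabilityMeasure μ]
    (hs : SphericallySymmetric μ) (hst : IsStableLaw α μ) :
    ∃ σ : ℝ, 0 < σ ∧ ∀ ξ, charFun μ ξ = (Real.exp (-(σ * ‖ξ‖) ^ α) : ℂ) := by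
  obtain ⟨e, he⟩ := exists_norm_eq E zero_le_one
  let g : ℝ → ℝ := fun t => (charFun μ (t • e)).re
  have hg : Continuous g := Complex.continuous_re.comp
    ((continuous_charFun (μ := μ)).comp (by fun_prop))
  have hgξ : ∀ ξ, charFun μ ξ = (g ‖ξ‖ : ℂ) := fun ξ => by
    rw [hs.charFun_eq_ofReal_re, hs.charFun_apply_eq (y := ‖ξ‖ • e) (by simp [norm_smul, he])]
  have hg0 : g 0 = 1 := by simp [g]
  have hmul : ∀ a b, 0 < a → 0 < b → g a * g b = g ((a ^ α + b ^ α) ^ (1 / α)) := by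
    intro a b ha hb
    obtain ⟨v, hv⟩ := hst.2 a b ha hb
    set c := (a ^ α + b ^ α) ^ (1 / α) with hc
    have hc0 : 0 ≤ c := by positivity
    have key : ∀ ξ, charFun μ (a • ξ) * charFun μ (b • ξ) =
        charFun μ (c • ξ) * cexp (⟪v, ξ⟫ * I) := by
      intro ξ
      rw [← charFun_map_prod_smul_add_smul, hv, charFun_map_smul_add_const]
    -- The left side of `key` is even in ξ, so its phase may be replaced by the conjugate phase.
    have hv0 : v = 0 := by
      refine eq_zero_of_forall_inner (μ := μ) (c := c) fun ξ => ?_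
      rw [← key ξ]
      have := key (-ξ)
      simp only [smul_neg, hs.charFun_apply_eq (norm_neg _), inner_neg_right] at this
      rw [this]
      push_cast
      rfl
    have := key e
    rw [hv0, hgξ, hgξ, hgξ] at this
    simp only [norm_smul, he, mul_one, Real.norm_eq_abs, abs_of_pos ha, abs_of_pos hb,
      abs_of_nonneg hc0, inner_zero_left, ofReal_zero, zero_mul, Complex.exp_zero] at this
    exact_mod_cast this
  obtain ⟨k, hk⟩ := exists_eq_exp_neg_mul_rpow hα hg hg0 hmul
  -- The bound |φ| ≤ 1 gives k ≤ 0, and k = 0 would make μ the point mass at 0.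
  have hk0 : k < 0 := by
    have hle : k ≤ 0 := by
      have h1 : |g 1| ≤ 1 :=
        (Complex.abs_re_le_norm _).trans (norm_charFun_le_one (μ := μ) _)
      rw [hk 1 zero_le_one, Real.one_rpow, mul_one, abs_of_pos (Real.exp_pos k),
        Real.exp_le_one_iff] at h1
      exact h1
    refine lt_of_le_of_ne hle fun h => hst.1 0 ?_
    refine Measure.ext_of_charFun (funext fun ξ => ?_)
    rw [hgξ, hk _ (norm_nonneg _), h, charFun_dirac]
    simp
  refine ⟨(-k) ^ (1 / α), Real.rpow_pos_of_pos (by linarith) _, fun ξ => ?_⟩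
  rw [hgξ, hk _ (norm_nonneg _),
    Real.mul_rpow (Real.rpow_nonneg (by linarith) _) (norm_nonneg _),
    ← Real.rpow_mul (by linarith), one_div_mul_cancel hα.ne', Real.rpow_one, neg_mul, neg_neg]

theorem isStableLaw_of_charFun_eq [BorelSpace E] [SecondCountableTopology E]
    [CompleteSpace E] [Nontrivial E] {α : ℝ} (hα : 0 < α) {μ : Measure E} [IsProbabilityMeasure μ]
    {σ : ℝ} (hσ : 0 < σ) (h : ∀ ξ, charFun μ ξ = (Real.exp (-(σ * ‖ξ‖) ^ α) : ℂ)) :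
    IsStableLaw α μ := by
  refine ⟨fun v hv => ?_, fun a b ha hb => ⟨0, ?_⟩⟩
  · obtain ⟨e, he⟩ := exists_norm_eq E zero_le_one
    have h1 := h e
    rw [hv, charFun_dirac] at h1
    -- A point mass has a characteristic function of modulus 1, but exp(-σ^α) < 1.
    have h2 := congrArg norm h1
    rw [Complex.norm_exp_ofReal_mul_I, Complex.norm_real, Real.norm_eq_abs, Real.abs_exp, he,
      mul_one] at h2
    have h3 : 0 < σ ^ α := by positivity
    have h4 : -σ ^ α = 0 := by rw [← Real.exp_eq_one_iff]; exact h2.symm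
    linarith
  · refine Measure.ext_of_charFun (funext fun ξ => ?_)
    rw [charFun_map_prod_smul_add_smul, charFun_map_smul_add_const, h, h, h]
    have hab : 0 ≤ a ^ α + b ^ α := by positivity
    simp only [inner_zero_left, ofReal_zero, zero_mul, Complex.exp_zero, mul_one, norm_smul,
      Real.norm_eq_abs, abs_of_pos ha, abs_of_pos hb, abs_of_nonneg (Real.rpow_nonneg hab _)]
    rw [← Complex.ofReal_mul, ← Real.exp_add, Real.mul_rpow hσ.le (by positivity),
      Real.mul_rpow hσ.le (by positivity), Real.mul_rpow hσ.le (by positivity),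
      Real.mul_rpow ha.le (norm_nonneg _), Real.mul_rpow hb.le (norm_nonneg _),
      Real.mul_rpow (by positivity) (norm_nonneg _), ← Real.rpow_mul hab,
      one_div_mul_cancel hα.ne', Real.rpow_one]
    congr 2
    ring

theorem sphericallySymmetric_and_isStableLaw_iff [BorelSpace E] [SecondCountableTopology E]
    [CompleteSpace E] [Nontrivial E] {α : ℝ} (hα : 0 < α) (μ : Measure E)
    [IsProbabilityMeasure μ] :
    (SphericallySymmetric μ ∧ IsStableLaw α μ) ↔
      ∃ σ : ℝ, 0 < σ ∧ ∀ ξ, charFun μ ξ = (Real.exp (-(σ * ‖ξ‖) ^ α) : ℂ) := by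
  refine ⟨fun h => h.1.exists_charFun_eq hα h.2, fun ⟨σ, hσ, h⟩ => ⟨?_, ?_⟩⟩
  · exact sphericallySymmetric_of_charFun fun x y hxy => by rw [h, h, hxy]
  · exact isStableLaw_of_charFun_eq hα hσ h

end StableCharFun

/-! ### Densities from integrable characteristic functions -/

section FourierDensity

open Complex Filter
open scoped RealInnerProductSpace FourierTransform Real

variable {V : Type*} [NormedAddCommGroup V] [InnerProductSpace ℝ V] [FiniteDimensional ℝ V]
  [MeasurableSpace V] [BorelSpace V]

/-- The density of a finite measure with integrable characteristic function, as the Fourier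
transform of the rescaled characteristic function. -/
noncomputable def fourierDensity (μ : Measure V) : V → ℂ :=
  𝓕 fun ζ : V => charFun μ ((2 * π) • ζ)

theorem integrable_charFun_two_pi_smul {μ : Measure V} (h : Integrable (charFun μ)) :
    Integrable fun ζ : V => charFun μ ((2 * π) • ζ) :=
  h.comp_smul (by positivity)

theorem continuous_fourierDensity {μ : Measure V} (h : Integrable (charFun μ)) :
    Continuous (fourierDensity μ) :=
  VectorFourier.fourierIntegral_continuous Real.continuous_fourierChar
    (by exact continuous_inner) (integrable_charFun_two_pi_smul h)

/-- Fubini's theorem; the factor 2π reconciles the kernel exp(i⟨x, ξ⟩) of the characteristic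
function with the kernel exp(2πi⟨x, ζ⟩) of `𝓕⁻`. -/
theorem integral_charFun_mul_eq_integral_fourierInv (μ : Measure V) [IsFiniteMeasure μ] {h : V → ℂ}
    (hh : Integrable h) :
    ∫ ζ, charFun μ ((2 * π) • ζ) * h ζ = ∫ x, 𝓕⁻ h x ∂μ := by
  have hint : Integrable (Function.uncurry fun (x ζ : V) =>
      cexp (↑(2 * π * ⟪ζ, x⟫) * I) * h ζ) (μ.prod volume) := by
    refine (hh.comp_snd μ).mono ?_ (ae_of_all _ fun p => ?_)
    · have h1 : AEStronglyMeasurable (fun p : V × V => h p.2) (μ.prod volume) :=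
        (hh.comp_snd μ).aestronglyMeasurable
      exact AEStronglyMeasurable.mul (by fun_prop) h1
    · simp only [Function.uncurry, norm_mul, Complex.norm_exp_ofReal_mul_I, one_mul, le_refl]
  simp_rw [Real.fourierInv_eq', smul_eq_mul]
  rw [integral_integral_swap hint]
  congr with ζ
  rw [integral_mul_const, charFun_apply]
  congr 2 with x
  rw [inner_smul_right, real_inner_comm]

theorem integrable_gaussian {b : ℝ} (hb : 0 < b) :
    Integrable fun v : V => cexp (-(b : ℂ) * (‖v‖ : ℂ) ^ 2) := by
  simpa using GaussianFourier.integrable_cexp_neg_mul_sq_norm_add (V := V) (b := b)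
    (by simpa using hb) 0 0

/-- A modulated Gaussian has as its inverse Fourier transform a real Gaussian centred at x. The
identity serves twice: its right side is nonnegative, and at x = 0 it computes a Laplace transform.
-/
theorem integral_gaussian_mul_charFun (μ : Measure V) [IsFiniteMeasure μ] (x : V) {b : ℝ}
    (hb : 0 < b) :
    ∫ ζ, cexp (-(b : ℂ) * (‖ζ‖ : ℂ) ^ 2) * (cexp (↑(-2 * π * ⟪ζ, x⟫) * I) *
        charFun μ ((2 * π) • ζ)) =
      (((π / b) ^ (Module.finrank ℝ V / 2 : ℝ) *
        ∫ y, Real.exp (-(π ^ 2 / b) * ‖x - y‖ ^ 2) ∂μ : ℝ) : ℂ) := by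
  have hb' : 0 < (b : ℂ).re := by simpa using hb
  have hh : Integrable fun ζ : V =>
      cexp (-(b : ℂ) * (‖ζ‖ : ℂ) ^ 2 + 2 * π * I * (⟪-x, ζ⟫ : ℝ)) :=
    GaussianFourier.integrable_cexp_neg_mul_sq_norm_add hb' _ _
  have h1 := integral_charFun_mul_eq_integral_fourierInv μ hh
  have h2 : ∀ y : V, 𝓕⁻ (fun ζ : V =>
      cexp (-(b : ℂ) * (‖ζ‖ : ℂ) ^ 2 + 2 * π * I * (⟪-x, ζ⟫ : ℝ))) y =
      (((π / b) ^ (Module.finrank ℝ V / 2 : ℝ) *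
        Real.exp (-(π ^ 2 / b) * ‖x - y‖ ^ 2) : ℝ) : ℂ) := by
    intro y
    rw [Real.fourierInv_eq_fourier_neg, fourier_gaussian_innerProductSpace' hb']
    push_cast
    rw [ofReal_cpow (by positivity)]
    push_cast
    rw [show ‖-x - -y‖ = ‖x - y‖ by rw [← norm_neg]; congr 1; abel]
    congr 2
    ring
  simp_rw [h2] at h1
  rw [integral_complex_ofReal, integral_const_mul] at h1
  rw [← h1]
  congr with ζ
  rw [← mul_assoc, ← Complex.exp_add, mul_comm]
  congr 2
  rw [inner_neg_left, real_inner_comm]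
  push_cast
  ring

/-- With a Gaussian cutoff the Fourier integral is a positive multiple of a Gaussian average of μ.
Removing the cutoff keeps the limit in the closed set of nonnegative reals. -/
theorem fourierDensity_nonneg {μ : Measure V} [IsFiniteMeasure μ]
    (h : Integrable (charFun μ)) (x : V) :
    0 ≤ (fourierDensity μ x).re ∧ (fourierDensity μ x).im = 0 := by
  have hi : Integrable fun ζ : V => cexp (↑(-2 * π * ⟪ζ, x⟫) * I) * charFun μ ((2 * π) • ζ) := by
    refine (integrable_charFun_two_pi_smul h).mono
      (AEStronglyMeasurable.mul (by fun_prop)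
        (integrable_charFun_two_pi_smul h).aestronglyMeasurable) (ae_of_all _ fun ζ => ?_)
    rw [norm_mul, Complex.norm_exp_ofReal_mul_I, one_mul]
  have ht := Real.tendsto_integral_cexp_sq_smul hi
  have hD : ∫ ζ : V, cexp (↑(-2 * π * ⟪ζ, x⟫) * I) * charFun μ ((2 * π) • ζ) =
      fourierDensity μ x := by
    rw [fourierDensity, Real.fourier_eq']
    simp only [smul_eq_mul]
  rw [hD] at ht
  have hev : ∀ᶠ c : ℝ in atTop,
      (∫ ζ : V, cexp (-(c⁻¹ : ℝ) * (‖ζ‖ : ℂ) ^ 2) • (cexp (↑(-2 * π * ⟪ζ, x⟫) * I) *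
        charFun μ ((2 * π) • ζ))) ∈ {z : ℂ | 0 ≤ z.re ∧ z.im = 0} := by
    filter_upwards [eventually_gt_atTop 0] with c hc
    simp only [smul_eq_mul]
    rw [integral_gaussian_mul_charFun μ x (inv_pos.2 hc)]
    refine ⟨?_, Complex.ofReal_im _⟩
    rw [Complex.ofReal_re]
    exact mul_nonneg (by positivity) (integral_nonneg fun y => (Real.exp_pos _).le)
  have hcl : IsClosed {z : ℂ | 0 ≤ z.re ∧ z.im = 0} :=
    (isClosed_le continuous_const Complex.continuous_re).inter
      (isClosed_eq Complex.continuous_im continuous_const)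
  refine hcl.mem_of_tendsto ?_ hev
  simpa using ht

theorem fourierDensity_eq_ofReal_re {μ : Measure V} [IsFiniteMeasure μ]
    (h : Integrable (charFun μ)) (x : V) :
    fourierDensity μ x = ((fourierDensity μ x).re : ℂ) :=
  Complex.ext (by simp) (by simp [(fourierDensity_nonneg h x).2])

theorem norm_fourierDensity_le (μ : Measure V) (x : V) :
    ‖fourierDensity μ x‖ ≤ ∫ ζ : V, ‖charFun μ ((2 * π) • ζ)‖ :=
  VectorFourier.norm_fourierIntegral_le_integral_norm _ _ _ _ _

/-- The Fourier transform is moved from the characteristic function to the Gaussian, then Fubini's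
theorem and inversion for the Gaussian bring in μ. -/
theorem integral_fourierDensity_mul_gaussian {μ : Measure V} [IsFiniteMeasure μ]
    (h : Integrable (charFun μ)) {b : ℝ} (hb : 0 < b) :
    ∫ x, (fourierDensity μ x).re * Real.exp (-b * ‖x‖ ^ 2) = ∫ x, Real.exp (-b * ‖x‖ ^ 2) ∂μ := by
  have hb' : 0 < (b : ℂ).re := by simpa using hb
  let g : V → ℂ := fun v => cexp (-(b : ℂ) * (‖v‖ : ℂ) ^ 2)
  have hg : Integrable g := integrable_gaussian hb
  have hgc : Continuous g := by fun_prop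
  have hFg : 𝓕 g = fun w => (π / b : ℂ) ^ (Module.finrank ℝ V / 2 : ℂ) *
      cexp (-((π ^ 2 / b : ℝ) : ℂ) * (‖w‖ : ℂ) ^ 2) := by
    ext w
    rw [fourier_gaussian_innerProductSpace hb']
    push_cast
    congr 2
    ring
  have hFgi : Integrable (𝓕 g) := by
    rw [hFg]
    exact (integrable_gaussian (by positivity)).const_mul _
  have h1 : ∫ x, 𝓕 (fun ζ : V => charFun μ ((2 * π) • ζ)) x • g x =
      ∫ ζ, charFun μ ((2 * π) • ζ) • 𝓕 g ζ := by
    simpa using! (VectorFourier.integral_fourierIntegral_smul_eq_flip (L := innerₗ V)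
      Real.continuous_fourierChar continuous_inner (integrable_charFun_two_pi_smul h) hg)
  simp only [smul_eq_mul] at h1
  rw [integral_charFun_mul_eq_integral_fourierInv μ hFgi, hgc.fourierInv_fourier_eq hg hFgi] at h1
  have e : ∀ x : V, g x = (Real.exp (-b * ‖x‖ ^ 2) : ℂ) := fun x => by simp [g]
  have e2 : ∀ x, 𝓕 (fun ζ : V => charFun μ ((2 * π) • ζ)) x = ((fourierDensity μ x).re : ℂ) :=
    fun x => fourierDensity_eq_ofReal_re h x
  simp_rw [e2, e, ← Complex.ofReal_mul] at h1
  rw [integral_complex_ofReal, integral_complex_ofReal] at h1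
  exact_mod_cast h1

/-- Fatou's lemma: against the weights exp(-‖x‖² / (n + 1)), which tend to 1, the density has
integral at most the mass of μ. -/
theorem integrable_fourierDensity {μ : Measure V} [IsFiniteMeasure μ]
    (h : Integrable (charFun μ)) : Integrable (fourierDensity μ) := by
  have hc := continuous_fourierDensity h
  refine ⟨hc.aestronglyMeasurable, ?_⟩
  rw [hasFiniteIntegral_iff_norm]
  let F : ℕ → V → ENNReal := fun n x =>
    ENNReal.ofReal ((fourierDensity μ x).re * Real.exp (-(1 / ((n : ℝ) + 1)) * ‖x‖ ^ 2))
  have hF : ∀ n, Measurable (F n) := fun n =>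
    (ENNReal.continuous_ofReal.comp ((Complex.continuous_re.comp hc).mul
      (by fun_prop))).measurable
  have hFle : ∀ n, ∫⁻ x, F n x ≤ μ Set.univ := by
    intro n
    have hb : 0 < 1 / ((n : ℝ) + 1) := by positivity
    rw [← ofReal_integral_eq_lintegral_ofReal, integral_fourierDensity_mul_gaussian h hb,
      ← ofReal_measureReal (measure_ne_top μ _)]
    · refine ENNReal.ofReal_le_ofReal ?_
      rw [← mul_one (μ.real Set.univ), ← smul_eq_mul, ← integral_const]
      refine integral_mono_of_nonneg (ae_of_all _ fun x => (Real.exp_pos _).le)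
        (integrable_const _) (ae_of_all _ fun x => ?_)
      exact Real.exp_le_one_iff.2 (by have := sq_nonneg ‖x‖; nlinarith)
    · have hg := ((integrable_gaussian (V := V) hb).norm.const_mul
        (∫ ζ : V, ‖charFun μ ((2 * π) • ζ)‖))
      refine hg.mono (((Complex.continuous_re.comp hc).mul
        (by fun_prop)).aestronglyMeasurable) (ae_of_all _ fun x => ?_)
      have e : ‖cexp (-((1 / ((n : ℝ) + 1) : ℝ) : ℂ) * (‖x‖ : ℂ) ^ 2)‖ =
          Real.exp (-(1 / ((n : ℝ) + 1)) * ‖x‖ ^ 2) := by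
        rw [← Complex.norm_of_nonneg (Real.exp_pos (-(1 / ((n : ℝ) + 1)) * ‖x‖ ^ 2)).le]
        push_cast
        rfl
      rw [norm_mul, norm_mul, e, Real.norm_eq_abs, Real.norm_eq_abs, Real.abs_exp,
        Real.norm_of_nonneg (integral_nonneg fun _ => norm_nonneg _)]
      exact mul_le_mul_of_nonneg_right
        ((Complex.abs_re_le_norm _).trans (norm_fourierDensity_le μ x)) (Real.exp_pos _).le
    · exact ae_of_all _ fun x => mul_nonneg (fourierDensity_nonneg h x).1 (Real.exp_pos _).le
  have hlim : ∀ x, Tendsto (fun n => F n x) atTop (nhds (ENNReal.ofReal ‖fourierDensity μ x‖)) := by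
    intro x
    have e : ‖fourierDensity μ x‖ = (fourierDensity μ x).re * Real.exp (-0 * ‖x‖ ^ 2) := by
      rw [neg_zero, zero_mul, Real.exp_zero, mul_one, fourierDensity_eq_ofReal_re h,
        Complex.norm_of_nonneg (fourierDensity_nonneg h x).1, Complex.ofReal_re]
    rw [e]
    refine ENNReal.tendsto_ofReal (Tendsto.const_mul _ ?_)
    exact (Real.continuous_exp.tendsto _).comp
      (tendsto_one_div_add_atTop_nhds_zero_nat.neg.mul_const _)
  calc ∫⁻ x, ENNReal.ofReal ‖fourierDensity μ x‖
      = ∫⁻ x, liminf (fun n => F n x) atTop :=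
        lintegral_congr fun x => (hlim x).liminf_eq.symm
    _ ≤ liminf (fun n => ∫⁻ x, F n x) atTop := lintegral_liminf_le hF
    _ ≤ μ Set.univ := by
        refine (liminf_le_liminf (Eventually.of_forall hFle)).trans ?_
        simp
    _ < ⊤ := measure_lt_top μ _

theorem eq_withDensity_fourierDensity {μ : Measure V} [IsFiniteMeasure μ]
    (h : Integrable (charFun μ)) :
    μ = volume.withDensity fun x => ENNReal.ofReal (fourierDensity μ x).re := by
  have hc := continuous_fourierDensity h
  have hi := integrable_fourierDensity h
  have : IsFiniteMeasure (volume.withDensity fun x => ENNReal.ofReal (fourierDensity μ x).re) :=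
    isFiniteMeasure_withDensity_ofReal hi.re.2
  have hψc : Continuous fun ζ : V => charFun μ ((2 * π) • ζ) :=
    (continuous_charFun (μ := μ)).comp (by fun_prop)
  have hm : Measurable fun x => ENNReal.ofReal (fourierDensity μ x).re :=
    (ENNReal.continuous_ofReal.comp (Complex.continuous_re.comp hc)).measurable
  refine Measure.ext_of_charFun (funext fun ξ => ?_)
  -- Inversion at ξ / 2π undoes the rescaling, so both measures have the same characteristic
  -- function.
  have hinv := congrFun (hψc.fourierInv_fourier_eq (integrable_charFun_two_pi_smul h) hi)
    ((2 * π)⁻¹ • ξ)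
  rw [smul_inv_smul₀ (by positivity)] at hinv
  rw [← hinv, charFun_apply, Real.fourierInv_eq', integral_withDensity_eq_integral_toReal_smul
    hm (ae_of_all _ fun x => ENNReal.ofReal_lt_top)]
  congr with x
  rw [ENNReal.toReal_ofReal (fourierDensity_nonneg h x).1, Complex.real_smul,
    ← fourierDensity_eq_ofReal_re h, smul_eq_mul, inner_smul_right, ← mul_assoc,
    mul_inv_cancel₀ (by positivity), one_mul]
  exact mul_comm _ _

end FourierDensity

/-! ### Moments of the norm, computed on the Fourier side -/

section NormMoments

open Complex Filter Set
open scoped RealInnerProductSpace FourierTransform Real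

theorem mellin_cexp_neg_mul {a : ℂ} (ha : 0 < a.re) {r : ℝ} (hr : 0 < r) :
    mellin (fun u : ℝ => cexp (-((r : ℂ) * u))) a = (1 / (r : ℂ)) ^ a * Gamma a :=
  Complex.integral_cpow_mul_exp_neg_mul_Ioi ha hr

theorem one_div_sq_cpow {r : ℝ} (hr : 0 < r) (a : ℂ) :
    (1 / ((r ^ 2 : ℝ) : ℂ)) ^ a = (r : ℂ) ^ (-(2 * a)) := by
  have hrc : (r : ℂ) ≠ 0 := ofReal_ne_zero.2 hr.ne'
  rw [← ofReal_one, ← ofReal_div, cpow_def_of_ne_zero (ofReal_ne_zero.2 (by positivity)),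
    cpow_def_of_ne_zero hrc, ← ofReal_log (by positivity), ← ofReal_log hr.le, one_div,
    Real.log_inv, Real.log_pow]
  push_cast
  ring_nf

variable {V : Type*} [NormedAddCommGroup V]

theorem integral_cpow_mul_exp_neg_mul_norm_sq {x : V} (hx : x ≠ 0) {a : ℂ} (ha : 0 < a.re) :
    ∫ u : ℝ in Ioi 0, (u : ℂ) ^ (a - 1) * (Real.exp (-u * ‖x‖ ^ 2) : ℂ) =
      Gamma a * (‖x‖ : ℂ) ^ (-(2 * a)) := by
  have hx' : 0 < ‖x‖ := norm_pos_iff.2 hx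
  have h := mellin_cexp_neg_mul ha (r := ‖x‖ ^ 2) (by positivity)
  rw [one_div_sq_cpow hx'] at h
  rw [mul_comm, ← h, mellin]
  congr with u
  rw [smul_eq_mul]
  push_cast
  ring_nf

/-- The substitution u ↦ 1/u leads to the Gamma integral at w/2. In the application ν = n/2 and c =
f(2πζ). -/
theorem integral_cpow_mul_exp_neg_inv_mul_norm_sq {ζ : V} (hζ : ζ ≠ 0) (c : ℝ) {w : ℂ}
    (hw : 0 < w.re) (ν : ℝ) :
    ∫ u : ℝ in Ioi 0, (u : ℂ) ^ ((ν - w / 2) - 1) *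
      (((u / π) ^ (-ν) * (Real.exp (-(π ^ 2 / u) * ‖ζ‖ ^ 2) * c) : ℝ) : ℂ) =
      (π : ℂ) ^ (ν - w) * Gamma (w / 2) * ((‖ζ‖ : ℂ) ^ (-w) * c) := by
  have hζ' : 0 < ‖ζ‖ := norm_pos_iff.2 hζ
  have h := mellin_cexp_neg_mul (a := w / 2) (by simpa using hw) (r := (π * ‖ζ‖) ^ 2)
    (by positivity)
  rw [one_div_sq_cpow (by positivity)] at h
  have h2 := mellin_comp_inv (fun u : ℝ => cexp (-((((π * ‖ζ‖) ^ 2 : ℝ) : ℂ) * u))) (-(w / 2))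
  rw [neg_neg, h, mellin] at h2
  have hπ : (π : ℂ) ≠ 0 := ofReal_ne_zero.2 Real.pi_ne_zero
  have e : ((π * ‖ζ‖ : ℝ) : ℂ) ^ (-(2 * (w / 2))) = (π : ℂ) ^ (-w) * (‖ζ‖ : ℂ) ^ (-w) := by
    rw [ofReal_mul, mul_cpow_ofReal_nonneg Real.pi_pos.le hζ'.le]
    ring_nf
  rw [e] at h2
  have : (π : ℂ) ^ (ν - w) * Gamma (w / 2) * ((‖ζ‖ : ℂ) ^ (-w) * c) =
      (π : ℂ) ^ (ν : ℂ) * c * ((π : ℂ) ^ (-w) * (‖ζ‖ : ℂ) ^ (-w) * Gamma (w / 2)) := by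
    rw [sub_eq_add_neg, cpow_add _ _ hπ]
    ring
  rw [this, ← h2, ← integral_const_mul]
  refine setIntegral_congr_fun measurableSet_Ioi fun u hu => ?_
  have hu' : (0 : ℝ) < u := hu
  have huc : (u : ℂ) ≠ 0 := ofReal_ne_zero.2 hu'.ne'
  have e1 : (((u / π) ^ (-ν) : ℝ) : ℂ) = (u : ℂ) ^ (-ν : ℂ) * (π : ℂ) ^ (ν : ℂ) := by
    rw [Real.div_rpow hu'.le Real.pi_pos.le, Real.rpow_neg Real.pi_pos.le, div_inv_eq_mul,
      ofReal_mul, ofReal_cpow hu'.le, ofReal_cpow Real.pi_pos.le]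
    push_cast
    rfl
  have e2 : (u : ℂ) ^ (-(w / 2) - 1) = (u : ℂ) ^ ((ν - w / 2) - 1) * (u : ℂ) ^ (-ν : ℂ) := by
    rw [← cpow_add _ _ huc]
    ring_nf
  simp only [smul_eq_mul]
  rw [ofReal_mul, e1, e2, ofReal_mul, ofReal_exp]
  push_cast
  have e3 : -((π : ℂ) ^ 2 / u) * (‖ζ‖ : ℂ) ^ 2 = -((π * ‖ζ‖ : ℂ) ^ 2 * (u : ℂ)⁻¹) := by
    ring
  rw [e3]
  ring

variable [MeasurableSpace V]

/-- The Laplace transform of the squared norm. -/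
noncomputable def laplaceNormSq (μ : Measure V) (u : ℝ) : ℝ :=
  ∫ x, Real.exp (-u * ‖x‖ ^ 2) ∂μ

theorem laplaceNormSq_nonneg (μ : Measure V) (u : ℝ) : 0 ≤ laplaceNormSq μ u :=
  integral_nonneg fun _ => (Real.exp_pos _).le

theorem laplaceNormSq_le_one (μ : Measure V) [IsProbabilityMeasure μ] {u : ℝ} (hu : 0 ≤ u) :
    laplaceNormSq μ u ≤ 1 := by
  have : ∫ _ : V, (1 : ℝ) ∂μ = 1 := by simp
  rw [← this]
  refine integral_mono_of_nonneg (ae_of_all _ fun x => (Real.exp_pos _).le)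
    (integrable_const _) (ae_of_all _ fun x => ?_)
  exact Real.exp_le_one_iff.2 (by have := sq_nonneg ‖x‖; nlinarith)

variable [InnerProductSpace ℝ V] [FiniteDimensional ℝ V] [BorelSpace V]

theorem continuousOn_laplaceNormSq (μ : Measure V) [IsProbabilityMeasure μ] :
    ContinuousOn (laplaceNormSq μ) (Ioi 0) := by
  refine continuousOn_of_dominated (bound := fun _ => 1) (fun u _ => by fun_prop)
    (fun u hu => ae_of_all _ fun x => ?_) (integrable_const _)
    (ae_of_all _ fun x => by fun_prop)
  rw [Real.norm_eq_abs, Real.abs_exp]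
  have hu' : (0 : ℝ) < u := hu
  exact Real.exp_le_one_iff.2 (by have := sq_nonneg ‖x‖; nlinarith)

/-- The choice b = π²/u in `integral_gaussian_mul_charFun` makes the Gaussian on the side of μ equal
to exp(-u‖x‖²). -/
theorem rpow_mul_laplaceNormSq {μ : Measure V} [IsFiniteMeasure μ] {f : V → ℝ}
    (hf : ∀ ξ, charFun μ ξ = (f ξ : ℂ)) {u : ℝ} (hu : 0 < u) :
    (u / π) ^ (Module.finrank ℝ V / 2 : ℝ) * laplaceNormSq μ u =
      ∫ ζ, Real.exp (-(π ^ 2 / u) * ‖ζ‖ ^ 2) * f ((2 * π) • ζ) := by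
  have h := integral_gaussian_mul_charFun μ 0 (b := π ^ 2 / u) (by positivity)
  have e : ∀ ζ : V, cexp (-((π ^ 2 / u : ℝ) : ℂ) * (‖ζ‖ : ℂ) ^ 2) *
      (cexp (↑(-2 * π * ⟪ζ, (0 : V)⟫) * I) * charFun μ ((2 * π) • ζ)) =
      ((Real.exp (-(π ^ 2 / u) * ‖ζ‖ ^ 2) * f ((2 * π) • ζ) : ℝ) : ℂ) := fun ζ => by
    rw [hf, inner_zero_right]
    push_cast
    simp
  simp_rw [e] at h
  rw [integral_complex_ofReal] at h
  have h' := Complex.ofReal_injective h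
  have e1 : π / (π ^ 2 / u) = u / π := by field_simp
  have e2 : π ^ 2 / (π ^ 2 / u) = u := by field_simp
  rw [h', laplaceNormSq, e1, e2]
  simp_rw [zero_sub, norm_neg]

/-- The Laplace transform is at most 1 near 0, and O(u^(-n/2)) at infinity because the
characteristic function is integrable. Both interchanges of integrals below rest on this. -/
theorem integrableOn_rpow_mul_laplaceNormSq {μ : Measure V} [IsProbabilityMeasure μ]
    {f : V → ℝ} (hf : ∀ ξ, charFun μ ξ = (f ξ : ℂ)) (hi : Integrable (charFun μ)) {s : ℝ}
    (hs : 0 < s) (hs' : s < Module.finrank ℝ V / 2) :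
    IntegrableOn (fun u => u ^ (s - 1) * laplaceNormSq μ u) (Ioi 0) := by
  refine mellin_convergent_of_isBigO_scalar (a := Module.finrank ℝ V / 2) (b := 0)
    ((continuousOn_laplaceNormSq μ).locallyIntegrableOn measurableSet_Ioi) ?_ hs' ?_ hs
  · refine Asymptotics.IsBigO.of_bound
      (π ^ (Module.finrank ℝ V / 2 : ℝ) * ∫ ζ : V, ‖f ((2 * π) • ζ)‖) ?_
    filter_upwards [eventually_gt_atTop 0] with u hu
    have h := rpow_mul_laplaceNormSq hf hu
    have hfi : Integrable fun ζ : V => ‖f ((2 * π) • ζ)‖ := by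
      have := (integrable_charFun_two_pi_smul hi).norm
      simpa [hf] using this
    have hle : (u / π) ^ (Module.finrank ℝ V / 2 : ℝ) * laplaceNormSq μ u ≤
        ∫ ζ : V, ‖f ((2 * π) • ζ)‖ := by
      rw [h]
      refine (le_abs_self _).trans ?_
      rw [← Real.norm_eq_abs]
      refine norm_integral_le_of_norm_le hfi (ae_of_all _ fun ζ => ?_)
      rw [norm_mul, Real.norm_eq_abs, Real.abs_exp]
      refine mul_le_of_le_one_left (norm_nonneg _) (Real.exp_le_one_iff.2 ?_)
      have : 0 ≤ π ^ 2 / u * ‖ζ‖ ^ 2 := by positivity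
      linarith
    rw [Real.norm_of_nonneg (laplaceNormSq_nonneg _ _), Real.norm_of_nonneg (by positivity),
      Real.rpow_neg hu.le, ← div_eq_mul_inv, le_div_iff₀ (by positivity)]
    rw [Real.div_rpow hu.le Real.pi_pos.le, div_mul_eq_mul_div, div_le_iff₀ (by positivity)] at hle
    linarith
  · refine Asymptotics.IsBigO.of_bound 1 ?_
    filter_upwards [self_mem_nhdsWithin] with u hu
    have hu' : (0 : ℝ) < u := hu
    rw [Real.norm_of_nonneg (laplaceNormSq_nonneg _ _), neg_zero, Real.rpow_zero]
    simpa using laplaceNormSq_le_one μ hu'.le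

theorem integrable_prod_cpow_mul_exp {μ : Measure V} [IsProbabilityMeasure μ]
    {f : V → ℝ} (hf : ∀ ξ, charFun μ ξ = (f ξ : ℂ)) (hi : Integrable (charFun μ)) {a : ℂ}
    (ha : 0 < a.re) (ha' : a.re < Module.finrank ℝ V / 2) :
    Integrable (fun p : V × ℝ => (p.2 : ℂ) ^ (a - 1) * (Real.exp (-p.2 * ‖p.1‖ ^ 2) : ℂ))
      (μ.prod (volume.restrict (Ioi 0))) := by
  have hm : Measurable fun p : V × ℝ => (p.2 : ℂ) ^ (a - 1) * (Real.exp (-p.2 * ‖p.1‖ ^ 2) : ℂ) := by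
    fun_prop
  rw [integrable_prod_iff' hm.aestronglyMeasurable]
  constructor
  · refine (ae_restrict_mem measurableSet_Ioi).mono fun u hu => ?_
    have hu' : (0 : ℝ) < u := hu
    simp only []
    refine Integrable.const_mul ?_ _
    have hb : Integrable (fun x : V => Real.exp (-u * ‖x‖ ^ 2)) μ := by
      refine (integrable_const (1 : ℝ)).mono (by fun_prop) (ae_of_all _ fun x => ?_)
      rw [Real.norm_eq_abs, Real.abs_exp, norm_one]
      exact Real.exp_le_one_iff.2 (by have := sq_nonneg ‖x‖; nlinarith)
    exact hb.ofReal
  · refine (integrableOn_rpow_mul_laplaceNormSq hf hi ha ha').congr_fun (fun u hu => ?_)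
      measurableSet_Ioi
    have hu' : (0 : ℝ) < u := hu
    simp only [norm_mul, Complex.norm_real, Real.norm_eq_abs, Real.abs_exp,
      Complex.norm_cpow_eq_rpow_re_of_pos hu', sub_re, one_re]
    rw [integral_const_mul, laplaceNormSq]

theorem continuous_of_charFun_eq {μ : Measure V} [IsFiniteMeasure μ]
    {f : V → ℝ} (hf : ∀ ξ, charFun μ ξ = (f ξ : ℂ)) : Continuous f := by
  have : f = fun ξ => (charFun μ ξ).re := by ext ξ; rw [hf, ofReal_re]
  rw [this]
  exact Complex.continuous_re.comp (continuous_charFun (μ := μ))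

/-- As f ≥ 0, integrating the norm over ζ gives back exactly u^(Re a - 1) times the Laplace
transform. -/
theorem integrable_prod_cpow_mul_exp_inv {μ : Measure V} [IsProbabilityMeasure μ]
    {f : V → ℝ} (hf : ∀ ξ, charFun μ ξ = (f ξ : ℂ)) (hf0 : ∀ ξ, 0 ≤ f ξ)
    (hi : Integrable (charFun μ)) {a : ℂ}
    (ha : 0 < a.re) (ha' : a.re < Module.finrank ℝ V / 2) :
    Integrable (fun p : V × ℝ => (p.2 : ℂ) ^ (a - 1) *
      (((p.2 / π) ^ (-(Module.finrank ℝ V / 2 : ℝ)) *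
        (Real.exp (-(π ^ 2 / p.2) * ‖p.1‖ ^ 2) * f ((2 * π) • p.1)) : ℝ) : ℂ))
      (volume.prod (volume.restrict (Ioi 0))) := by
  have hfm : Measurable f := (continuous_of_charFun_eq hf).measurable
  have hm : Measurable (fun p : V × ℝ => (p.2 : ℂ) ^ (a - 1) *
      (((p.2 / π) ^ (-(Module.finrank ℝ V / 2 : ℝ)) *
        (Real.exp (-(π ^ 2 / p.2) * ‖p.1‖ ^ 2) * f ((2 * π) • p.1)) : ℝ) : ℂ)) := by
    fun_prop
  rw [integrable_prod_iff' hm.aestronglyMeasurable]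
  have hfi : Integrable fun ζ : V => f ((2 * π) • ζ) := by
    have := (integrable_charFun_two_pi_smul hi).re
    simpa [hf] using this
  constructor
  · refine (ae_restrict_mem measurableSet_Ioi).mono fun u hu => ?_
    have hu' : (0 : ℝ) < u := hu
    simp only []
    refine Integrable.const_mul ?_ _
    refine Integrable.ofReal (Integrable.const_mul (hfi.mono ?_ (ae_of_all _ fun ζ => ?_)) _)
    · exact Measurable.aestronglyMeasurable (by fun_prop)
    · rw [norm_mul, Real.norm_eq_abs, Real.abs_exp]
      refine mul_le_of_le_one_left (norm_nonneg _) (Real.exp_le_one_iff.2 ?_)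
      have : 0 ≤ π ^ 2 / u * ‖ζ‖ ^ 2 := by positivity
      linarith
  · refine (integrableOn_rpow_mul_laplaceNormSq hf hi ha ha').congr_fun (fun u hu => ?_)
      measurableSet_Ioi
    have hu' : (0 : ℝ) < u := hu
    have e : ∀ ζ : V, ‖((((u / π) ^ (-(Module.finrank ℝ V / 2 : ℝ)) *
        (Real.exp (-(π ^ 2 / u) * ‖ζ‖ ^ 2) * f ((2 * π) • ζ)) : ℝ) : ℂ))‖ =
        (u / π) ^ (-(Module.finrank ℝ V / 2 : ℝ)) *
        (Real.exp (-(π ^ 2 / u) * ‖ζ‖ ^ 2) * f ((2 * π) • ζ)) := fun ζ =>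
      Complex.norm_of_nonneg (mul_nonneg (by positivity) (mul_nonneg (by positivity) (hf0 _)))
    simp only [norm_mul (_ ^ (a - 1)), e, Complex.norm_cpow_eq_rpow_re_of_pos hu', sub_re, one_re]
    rw [integral_const_mul, integral_const_mul, ← rpow_mul_laplaceNormSq hf hu',
      Real.rpow_neg (by positivity), inv_mul_cancel_left₀ (by positivity)]

theorem integrable_norm_cpow_of_charFun {μ : Measure V} [IsProbabilityMeasure μ]
    {f : V → ℝ} (hf : ∀ ξ, charFun μ ξ = (f ξ : ℂ)) (hi : Integrable (charFun μ))
    (hμ : μ {0} = 0) {w : ℂ} (hw : 0 < w.re) (hw' : w.re < Module.finrank ℝ V) :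
    Integrable (fun x : V => (‖x‖ : ℂ) ^ (w - Module.finrank ℝ V)) μ := by
  set n := Module.finrank ℝ V
  have hre : (((n : ℂ) - w) / 2).re = (n - w.re) / 2 := by
    simp
  have ha : 0 < (((n : ℂ) - w) / 2).re := by rw [hre]; linarith
  have ha' : (((n : ℂ) - w) / 2).re < n / 2 := by rw [hre]; linarith
  have h := (integrable_prod_cpow_mul_exp hf hi ha ha').integral_prod_left.const_mul
    (Gamma (((n : ℂ) - w) / 2))⁻¹
  refine h.congr ?_
  have : ∀ᵐ x ∂μ, x ≠ 0 := by rw [ae_iff]; simpa using hμ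
  filter_upwards [this] with x hx
  rw [integral_cpow_mul_exp_neg_mul_norm_sq hx ha,
    inv_mul_cancel_left₀ (Gamma_ne_zero_of_re_pos ha)]
  congr 1
  ring

variable [Nontrivial V]

/-- The integral of u^(a - 1) times the Laplace transform, with a = (n - w)/2, is evaluated twice by
Fubini's theorem: over x under μ, and over ζ on the Fourier side. -/
theorem Gamma_mul_integral_norm_cpow {μ : Measure V} [IsProbabilityMeasure μ]
    {f : V → ℝ} (hf : ∀ ξ, charFun μ ξ = (f ξ : ℂ)) (hf0 : ∀ ξ, 0 ≤ f ξ)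
    (hi : Integrable (charFun μ))
    (hμ : μ {0} = 0) {w : ℂ} (hw : 0 < w.re) (hw' : w.re < Module.finrank ℝ V) :
    Gamma ((Module.finrank ℝ V - w) / 2) * ∫ x : V, (‖x‖ : ℂ) ^ (w - Module.finrank ℝ V) ∂μ =
      (π : ℂ) ^ ((Module.finrank ℝ V / 2 : ℂ) - w) * Gamma (w / 2) *
        ∫ ζ : V, (‖ζ‖ : ℂ) ^ (-w) * f ((2 * π) • ζ) := by
  set n := Module.finrank ℝ V
  have hre : (((n : ℂ) - w) / 2).re = (n - w.re) / 2 := by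
    simp
  have ha : 0 < (((n : ℂ) - w) / 2).re := by rw [hre]; linarith
  have ha' : (((n : ℂ) - w) / 2).re < n / 2 := by rw [hre]; linarith
  have h1 := integral_integral_swap (f := fun (x : V) (u : ℝ) =>
    (u : ℂ) ^ (((n : ℂ) - w) / 2 - 1) * (Real.exp (-u * ‖x‖ ^ 2) : ℂ))
    (integrable_prod_cpow_mul_exp hf hi ha ha')
  have h2 := integral_integral_swap (f := fun (ζ : V) (u : ℝ) =>
    (u : ℂ) ^ (((n : ℂ) - w) / 2 - 1) * (((u / π) ^ (-(n / 2 : ℝ)) *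
      (Real.exp (-(π ^ 2 / u) * ‖ζ‖ ^ 2) * f ((2 * π) • ζ)) : ℝ) : ℂ))
    (integrable_prod_cpow_mul_exp_inv hf hf0 hi ha ha')
  have hμ' : ∀ᵐ x ∂μ, x ≠ 0 := by rw [ae_iff]; simpa using hμ
  have hv' : ∀ᵐ x : V, x ≠ 0 := by rw [ae_iff]; simp
  have hE : (fun u : ℝ => ∫ x, (u : ℂ) ^ (((n : ℂ) - w) / 2 - 1) *
        (Real.exp (-u * ‖x‖ ^ 2) : ℂ) ∂μ) =ᵐ[volume.restrict (Ioi 0)]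
      fun u : ℝ => ∫ ζ : V, (u : ℂ) ^ (((n : ℂ) - w) / 2 - 1) *
        (((u / π) ^ (-(n / 2 : ℝ)) *
          (Real.exp (-(π ^ 2 / u) * ‖ζ‖ ^ 2) * f ((2 * π) • ζ)) : ℝ) : ℂ) := by
    refine (ae_restrict_mem measurableSet_Ioi).mono fun u hu => ?_
    have hu' : (0 : ℝ) < u := hu
    simp only []
    rw [integral_const_mul, integral_const_mul, integral_complex_ofReal, integral_complex_ofReal,
      integral_const_mul, ← rpow_mul_laplaceNormSq hf hu', Real.rpow_neg (by positivity),
      inv_mul_cancel_left₀ (by positivity), laplaceNormSq]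
  rw [integral_congr_ae hE, ← h2] at h1
  have e1 : ∫ x : V, Gamma (((n : ℂ) - w) / 2) * (‖x‖ : ℂ) ^ (w - n) ∂μ =
      ∫ x : V, (∫ u : ℝ in Ioi 0, (u : ℂ) ^ (((n : ℂ) - w) / 2 - 1) *
        (Real.exp (-u * ‖x‖ ^ 2) : ℂ)) ∂μ := by
    refine integral_congr_ae ?_
    filter_upwards [hμ'] with x hx
    rw [integral_cpow_mul_exp_neg_mul_norm_sq hx ha]
    congr 2
    ring
  have e2 : ∫ ζ : V, (π : ℂ) ^ ((n / 2 : ℂ) - w) * Gamma (w / 2) *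
        ((‖ζ‖ : ℂ) ^ (-w) * f ((2 * π) • ζ)) =
      ∫ ζ : V, ∫ u : ℝ in Ioi 0, (u : ℂ) ^ (((n : ℂ) - w) / 2 - 1) *
        (((u / π) ^ (-(n / 2 : ℝ)) *
          (Real.exp (-(π ^ 2 / u) * ‖ζ‖ ^ 2) * f ((2 * π) • ζ)) : ℝ) : ℂ) := by
    refine integral_congr_ae ?_
    filter_upwards [hv'] with ζ hζ
    have := integral_cpow_mul_exp_neg_inv_mul_norm_sq hζ (f ((2 * π) • ζ)) hw (n / 2)
    push_cast at this
    rw [← this, show ((n : ℂ) - w) / 2 = n / 2 - w / 2 by ring]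
    push_cast
    rfl
  rw [← integral_const_mul, ← integral_const_mul, e1, e2]
  exact h1

end NormMoments

/-! ### Mellin transform of the radial profile -/

section RadialProfile

open Complex Filter Set
open scoped RealInnerProductSpace FourierTransform Real

theorem mellin_exp_neg_mul_rpow {α c : ℝ} (hα : 0 < α) (hc : 0 < c) {s : ℂ} (hs : 0 < s.re) :
    mellin (fun t : ℝ => (Real.exp (-(c * t) ^ α) : ℂ)) s =
      (c : ℂ) ^ (-s) * ((α : ℂ)⁻¹ * Gamma (s / α)) := by
  have h1 := mellin_comp_mul_left (fun t : ℝ => (Real.exp (-t ^ α) : ℂ)) s hc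
  have h2 := mellin_comp_rpow (fun t : ℝ => (Real.exp (-t) : ℂ)) s α
  rw [h1, h2, Gamma_eq_integral (by rw [div_ofReal_re]; positivity),
    GammaIntegral_eq_mellin, abs_of_pos hα, smul_eq_mul, real_smul, ofReal_inv]

theorem pow_pred_smul_cpow_mul {n : ℕ} (hn : 0 < n) {r : ℝ} (hr : 0 < r) (s c : ℂ) :
    (r ^ (n - 1)) • ((r : ℂ) ^ (s - n) * c) = (r : ℂ) ^ (s - 1) • c := by
  have hr' : (r : ℂ) ≠ 0 := ofReal_ne_zero.2 hr.ne'
  rw [real_smul, smul_eq_mul, ofReal_pow, ← cpow_natCast, ← mul_assoc, ← cpow_add _ _ hr',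
    Nat.cast_pred hn]
  congr 2
  ring

variable {V : Type*} [NormedAddCommGroup V] [InnerProductSpace ℝ V] [FiniteDimensional ℝ V]
  [MeasurableSpace V] [BorelSpace V]

theorem fourierDensity_eq_of_norm_eq {μ : Measure V}
    (hf : ∀ x y, ‖x‖ = ‖y‖ → charFun μ x = charFun μ y) {x y : V} (hxy : ‖x‖ = ‖y‖) :
    fourierDensity μ x = fourierDensity μ y := by
  obtain ⟨U, rfl⟩ := exists_linearIsometryEquiv_apply_eq hxy
  rw [fourierDensity, ← Real.fourier_comp_linearIsometry]
  refine congrArg (fun g : V → ℂ => 𝓕 g x) (funext fun ζ => ?_)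
  exact hf _ _ (by simp [norm_smul])

theorem fourierDensity_eq_radial {μ : Measure V}
    (hf : ∀ x y, ‖x‖ = ‖y‖ → charFun μ x = charFun μ y) {e : V} (he : ‖e‖ = 1) (x : V) :
    fourierDensity μ x = fourierDensity μ (‖x‖ • e) :=
  fourierDensity_eq_of_norm_eq hf (by simp [norm_smul, he])

variable [Nontrivial V]

/-- Polar coordinates. The constant is the area of the unit sphere; it later occurs on both sides
and cancels without being computed. -/
theorem integral_norm_cpow_mul_radial (g : ℝ → ℂ) (s : ℂ) :
    ∫ x : V, (‖x‖ : ℂ) ^ (s - Module.finrank ℝ V) * g ‖x‖ =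
      (Module.finrank ℝ V * (volume : Measure V).real (Metric.ball 0 1) : ℝ) * mellin g s := by
  rw [integral_fun_norm_addHaar volume
    (fun r : ℝ => (r : ℂ) ^ (s - Module.finrank ℝ V) * g r), mellin,
    setIntegral_congr_fun measurableSet_Ioi fun r hr =>
      pow_pred_smul_cpow_mul Module.finrank_pos hr s (g r)]
  rw [nsmul_eq_mul, real_smul]
  push_cast
  ring

theorem integrable_norm_cpow_mul_radial_iff (g : ℝ → ℂ) (s : ℂ) :
    Integrable (fun x : V => (‖x‖ : ℂ) ^ (s - Module.finrank ℝ V) * g ‖x‖) ↔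
      MellinConvergent g s := by
  rw [integrable_fun_norm_addHaar volume
    (f := fun r : ℝ => (r : ℂ) ^ (s - Module.finrank ℝ V) * g r), MellinConvergent]
  exact integrableOn_congr_fun (fun r hr =>
      pow_pred_smul_cpow_mul Module.finrank_pos hr s (g r)) measurableSet_Ioi

theorem integrable_of_charFun_eq_exp_neg_norm_rpow {α : ℝ} (hα : 0 < α) {μ : Measure V}
    (hμ : ∀ ξ, charFun μ ξ = (Real.exp (-‖ξ‖ ^ α) : ℂ)) : Integrable (charFun μ) := by
  have hn : 0 < Module.finrank ℝ V := Module.finrank_pos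
  have h : MellinConvergent (fun t : ℝ => (Real.exp (-t ^ α) : ℂ)) (Module.finrank ℝ V) := by
    -- A divergent Mellin integral would have the default value 0, but the formula gives a nonzero
    -- Gamma value.
    by_contra hc
    have h1 := mellin_exp_neg_mul_rpow hα one_pos (s := Module.finrank ℝ V) (by simpa using hn)
    simp only [one_mul, ofReal_one, one_cpow] at h1
    rw [mellin, integral_undef hc, zero_eq_mul] at h1
    rcases h1 with h1 | h1
    · exact hα.ne' (by simpa using h1)
    · refine Gamma_ne_zero_of_re_pos ?_ h1
      rw [div_ofReal_re, natCast_re]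
      positivity
  rw [← integrable_norm_cpow_mul_radial_iff (V := V)] at h
  simp only [sub_self, cpow_zero, one_mul] at h
  exact h.congr (ae_of_all _ fun ξ => (hμ ξ).symm)

/-- The Mellin transform of the radial profile of the isotropic stable density. -/
theorem hasMellin_fourierDensity {α : ℝ} (hα : 0 < α) {μ : Measure V} [IsProbabilityMeasure μ]
    (hμ : ∀ ξ, charFun μ ξ = (Real.exp (-‖ξ‖ ^ α) : ℂ)) {e : V} (he : ‖e‖ = 1) {w : ℂ}
    (hw : 0 < w.re) (hw' : w.re < Module.finrank ℝ V) :
    HasMellin (fun r : ℝ => fourierDensity μ (r • e)) w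
      ((π : ℂ) ^ ((Module.finrank ℝ V / 2 : ℂ) - w) * Gamma (w / 2) *
        (((2 * π : ℝ) : ℂ) ^ (w - Module.finrank ℝ V) *
          ((α : ℂ)⁻¹ * Gamma ((Module.finrank ℝ V - w) / α))) /
        Gamma ((Module.finrank ℝ V - w) / 2)) := by
  set n := Module.finrank ℝ V with hn_def
  have hn : 0 < n := Module.finrank_pos
  have hi := integrable_of_charFun_eq_exp_neg_norm_rpow hα hμ
  have hrad := fourierDensity_eq_radial (μ := μ) (fun x y hxy => by rw [hμ, hμ, hxy]) he
  have hwd := eq_withDensity_fourierDensity hi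
  have hc := continuous_fourierDensity hi
  have hm : Measurable fun x => ENNReal.ofReal (fourierDensity μ x).re :=
    (ENNReal.continuous_ofReal.comp (Complex.continuous_re.comp hc)).measurable
  -- Having a density, μ does not charge the singularity of the power of the norm.
  have hμ0 : μ {0} = 0 := by
    rw [hwd]
    exact withDensity_absolutelyContinuous _ _ (measure_singleton 0)
  have hf0 : ∀ ξ : V, 0 ≤ Real.exp (-‖ξ‖ ^ α) := fun ξ => (Real.exp_pos _).le
  have hE : ∀ x : V, (ENNReal.ofReal (fourierDensity μ x).re).toReal • (‖x‖ : ℂ) ^ (w - n) =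
      (‖x‖ : ℂ) ^ (w - n) * fourierDensity μ (‖x‖ • e) := fun x => by
    rw [ENNReal.toReal_ofReal (fourierDensity_nonneg hi x).1, real_smul,
      ← fourierDensity_eq_ofReal_re hi, ← hrad, mul_comm]
  have hconv := integrable_norm_cpow_of_charFun hμ hi hμ0 hw hw'
  have hint := Gamma_mul_integral_norm_cpow hμ hf0 hi hμ0 hw hw'
  rw [← hn_def] at hconv hint
  have hden : ∫ x : V, (‖x‖ : ℂ) ^ (w - n) ∂μ =
      ∫ x : V, (‖x‖ : ℂ) ^ (w - n) * fourierDensity μ (‖x‖ • e) := by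
    conv_lhs => rw [hwd]
    rw [integral_withDensity_eq_integral_toReal_smul hm
      (ae_of_all _ fun x => ENNReal.ofReal_lt_top)]
    exact integral_congr_ae (ae_of_all _ hE)
  have hconv' : Integrable fun x : V => (‖x‖ : ℂ) ^ (w - n) * fourierDensity μ (‖x‖ • e) := by
    rw [hwd, integrable_withDensity_iff_integrable_smul' hm
      (ae_of_all _ fun x => ENNReal.ofReal_lt_top)] at hconv
    exact hconv.congr (ae_of_all _ hE)
  refine ⟨(integrable_norm_cpow_mul_radial_iff _ w).1 hconv', ?_⟩
  rw [hden, integral_norm_cpow_mul_radial (fun r : ℝ => fourierDensity μ (r • e)) w] at hint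
  have hR : ∫ ζ : V, (‖ζ‖ : ℂ) ^ (-w) * (Real.exp (-‖(2 * π) • ζ‖ ^ α) : ℂ) =
      ∫ ζ : V, (‖ζ‖ : ℂ) ^ ((n - w) - n) * (Real.exp (-(2 * π * ‖ζ‖) ^ α) : ℂ) := by
    congr with ζ
    rw [norm_smul, Real.norm_of_nonneg (by positivity)]
    congr 2
    ring
  rw [hR, integral_norm_cpow_mul_radial (fun r : ℝ => (Real.exp (-(2 * π * r) ^ α) : ℂ)),
    mellin_exp_neg_mul_rpow hα (by positivity) (by simpa using hw'), neg_sub] at hint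
  have hS : ((n * (volume : Measure V).real (Metric.ball 0 1) : ℝ) : ℂ) ≠ 0 := by
    refine ofReal_ne_zero.2 (mul_ne_zero (by positivity) ?_)
    exact (ENNReal.toReal_pos (Metric.measure_ball_pos volume 0 one_pos).ne'
      measure_ball_lt_top.ne).ne'
  have hG : Gamma ((n - w) / 2) ≠ 0 := by
    refine Gamma_ne_zero_of_re_pos ?_
    simpa using hw'
  rw [eq_div_iff hG]
  refine mul_left_cancel₀ hS ?_
  linear_combination hint

end RadialProfile

/-! ### Growth of the Gamma function on vertical lines -/

section GammaBounds

open Complex Set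
open scoped Real

theorem norm_Gamma_le_Gamma_re {s : ℂ} (hs : 0 < s.re) : ‖Complex.Gamma s‖ ≤ Real.Gamma s.re := by
  rw [Complex.Gamma_eq_integral hs, Real.Gamma_eq_integral hs, Complex.GammaIntegral]
  refine (norm_integral_le_integral_norm _).trans_eq
    (setIntegral_congr_fun measurableSet_Ioi fun x hx => ?_)
  simp only [norm_mul, Complex.norm_real, Real.norm_eq_abs, Real.abs_exp,
    Complex.norm_cpow_eq_rpow_re_of_pos (show (0 : ℝ) < x from hx), sub_re, one_re]

/-- Since s Γ(s) = Γ(s + 1), each step to the next vertical line on the right gains one power of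
|t|. -/
theorem one_add_abs_pow_mul_norm_Gamma_le (N : ℕ) {g : ℝ} (hg : 0 < g) :
    ∃ C : ℝ, 0 < C ∧ ∀ t : ℝ, (1 + |t|) ^ N * ‖Complex.Gamma (g + t * I)‖ ≤ C := by
  induction N generalizing g with
  | zero =>
    refine ⟨Real.Gamma g, Real.Gamma_pos_of_pos hg, fun t => ?_⟩
    have := norm_Gamma_le_Gamma_re (s := g + t * I) (by simpa using hg)
    simpa using this
  | succ N ih =>
    obtain ⟨C, hC, h⟩ := ih (g := g + 1) (by linarith)
    refine ⟨(1 + 1 / g) * C, by positivity, fun t => ?_⟩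
    have h1 : g ≤ ‖(g + t * I : ℂ)‖ := by
      refine le_trans ?_ (Complex.abs_re_le_norm _)
      simpa using le_abs_self g
    have h2 : |t| ≤ ‖(g + t * I : ℂ)‖ := by
      simpa using Complex.abs_im_le_norm (g + t * I : ℂ)
    have hs0 : (g + t * I : ℂ) ≠ 0 := norm_pos_iff.1 (hg.trans_le h1)
    have h3 : 1 + |t| ≤ (1 + 1 / g) * ‖(g + t * I : ℂ)‖ := by
      have : 1 ≤ 1 / g * ‖(g + t * I : ℂ)‖ := by
        rw [one_div_mul_eq_div, one_le_div hg]
        exact h1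
      linarith
    have h4 := h t
    rw [show ((g + 1 : ℝ) : ℂ) + t * I = (g + t * I) + 1 by push_cast; ring,
      Complex.Gamma_add_one _ hs0, norm_mul] at h4
    calc (1 + |t|) ^ (N + 1) * ‖Complex.Gamma (g + t * I)‖
        = (1 + |t|) * ((1 + |t|) ^ N * ‖Complex.Gamma (g + t * I)‖) := by ring
      _ ≤ ((1 + 1 / g) * ‖(g + t * I : ℂ)‖) * ((1 + |t|) ^ N * ‖Complex.Gamma (g + t * I)‖) := by
        gcongr
      _ = (1 + 1 / g) *
          ((1 + |t|) ^ N * (‖(g + t * I : ℂ)‖ * ‖Complex.Gamma (g + t * I)‖)) := by ring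
      _ ≤ (1 + 1 / g) * C := by gcongr

/-- In Γ(s) Γ(b) = Γ(s + b) B(s, b) the Beta integral is bounded by a constant depending only on Re
s and b. -/
theorem norm_Gamma_le_mul_norm_Gamma_add {a b : ℝ} (ha : 0 < a) (hb : 0 < b) :
    ∃ C : ℝ, 0 < C ∧ ∀ t : ℝ, ‖Complex.Gamma (a + t * I)‖ ≤
      C * ‖Complex.Gamma (((a + b : ℝ) : ℂ) + t * I)‖ := by
  let B : ℝ := ∫ x in (0 : ℝ)..1, ‖(x : ℂ) ^ ((a : ℂ) - 1) * (1 - (x : ℂ)) ^ ((b : ℂ) - 1)‖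
  have hG : 0 < ‖Complex.Gamma b‖ :=
    norm_pos_iff.2 (Complex.Gamma_ne_zero_of_re_pos (by simpa using hb))
  have hB : 0 ≤ B := intervalIntegral.integral_nonneg zero_le_one fun _ _ => norm_nonneg _
  refine ⟨(B + 1) / ‖Complex.Gamma b‖, by positivity, fun t => ?_⟩
  have h := Complex.Gamma_mul_Gamma_eq_betaIntegral (s := a + t * I) (t := b)
    (by simpa using ha) (by simpa using hb)
  have hβ : ‖Complex.betaIntegral (a + t * I) b‖ ≤ B := by
    rw [Complex.betaIntegral]
    refine (intervalIntegral.norm_integral_le_integral_norm zero_le_one).trans_eq ?_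
    refine intervalIntegral.integral_congr_ae (ae_of_all _ fun x hx => ?_)
    rw [uIoc_of_le zero_le_one] at hx
    rw [norm_mul, norm_mul, Complex.norm_cpow_eq_rpow_re_of_pos hx.1,
      Complex.norm_cpow_eq_rpow_re_of_pos hx.1]
    simp
  have h1 := congrArg norm h
  rw [norm_mul, norm_mul] at h1
  rw [div_mul_eq_mul_div, le_div_iff₀ hG, h1, mul_comm (B + 1)]
  rw [show (a : ℂ) + t * I + b = ((a + b : ℝ) : ℂ) + t * I by push_cast; ring]
  gcongr
  linarith

theorem norm_Gamma_add_nat_le (N : ℕ) {s : ℂ} (hs : 0 < s.re) :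
    ‖Complex.Gamma (s + N)‖ ≤ (‖s‖ + N) ^ N * ‖Complex.Gamma s‖ := by
  induction N with
  | zero => simp
  | succ N ih =>
    have hN : s + N ≠ 0 := by
      intro h
      have := congrArg Complex.re h
      simp only [add_re, natCast_re, zero_re] at this
      have hN' : (0 : ℝ) ≤ N := Nat.cast_nonneg N
      linarith
    rw [Nat.cast_succ, ← add_assoc, Complex.Gamma_add_one _ hN, norm_mul]
    have h1 : ‖s + N‖ ≤ ‖s‖ + (N + 1) := by
      refine (norm_add_le _ _).trans ?_
      simp
    calc ‖s + N‖ * ‖Complex.Gamma (s + N)‖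
        ≤ (‖s‖ + (N + 1)) * ((‖s‖ + N) ^ N * ‖Complex.Gamma s‖) := by gcongr
      _ ≤ (‖s‖ + (N + 1)) * ((‖s‖ + (N + 1)) ^ N * ‖Complex.Gamma s‖) := by
        gcongr
        linarith
      _ = (‖s‖ + (N + 1 : ℕ)) ^ (N + 1) * ‖Complex.Gamma s‖ := by
        push_cast
        ring

/-- On two vertical lines in the right half plane the Gamma function differs at most by a factor of
polynomial growth. -/
theorem norm_Gamma_le_pow_mul_norm_Gamma {a c : ℝ} (ha : 0 < a) (hc : 0 < c) :
    ∃ C : ℝ, 0 < C ∧ ∃ N : ℕ, ∀ t : ℝ, ‖Complex.Gamma (a + t * I)‖ ≤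
      C * (1 + |t|) ^ N * ‖Complex.Gamma (c + t * I)‖ := by
  -- From the line a one passes to c + N > a by the Beta bound, then back to c by N uses of the
  -- functional equation.
  obtain ⟨N, hN⟩ := exists_nat_gt (a - c)
  obtain ⟨C, hC, h⟩ := norm_Gamma_le_mul_norm_Gamma_add ha (b := c + N - a) (by linarith)
  refine ⟨C * (c + N + 1) ^ N, by positivity, N, fun t => ?_⟩
  have h1 := norm_Gamma_add_nat_le N (s := c + t * I) (by simpa using hc)
  have h2 : ‖(c + t * I : ℂ)‖ + N ≤ (c + N + 1) * (1 + |t|) := by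
    have h3 : ‖(c + t * I : ℂ)‖ ≤ c + |t| := by
      refine (norm_add_le _ _).trans ?_
      simp [abs_of_pos hc]
    have h4 : 0 ≤ (c + N) * |t| := by positivity
    nlinarith
  have h3 := h t
  rw [show ((a + (c + N - a) : ℝ) : ℂ) + t * I = c + t * I + N by push_cast; ring] at h3
  calc ‖Complex.Gamma (a + t * I)‖ ≤ C * ‖Complex.Gamma (c + t * I + N)‖ := h3
    _ ≤ C * (((c + N + 1) * (1 + |t|)) ^ N * ‖Complex.Gamma (c + t * I)‖) := by
      gcongr
      refine h1.trans ?_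
      gcongr
    _ = C * (c + N + 1) ^ N * (1 + |t|) ^ N * ‖Complex.Gamma (c + t * I)‖ := by
      rw [mul_pow]
      ring

theorem norm_Gamma_sub_mul_I (a t : ℝ) :
    ‖Complex.Gamma (a - t * I)‖ = ‖Complex.Gamma (a + t * I)‖ := by
  have : (a - t * I : ℂ) = (starRingEnd ℂ) (a + t * I) := by
    simp [sub_eq_add_neg]
  rw [this, Complex.Gamma_conj, Complex.norm_conj]

theorem continuous_Gamma_vertical {a : ℝ} (ha : 0 < a) (b : ℝ) :
    Continuous fun t : ℝ => Complex.Gamma (a + b * t * I) := by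
  refine continuous_iff_continuousAt.2 fun t => ?_
  refine ContinuousAt.comp (f := fun t : ℝ => (a + b * t * I : ℂ)) (g := Complex.Gamma) ?_
    (by fun_prop)
  refine (Complex.differentiableAt_Gamma _ fun m h => ?_).continuousAt
  have := congrArg Complex.re h
  simp at this
  have hm : (0 : ℝ) ≤ m := Nat.cast_nonneg m
  linarith

end GammaBounds

/-! ### The Fox kernel and absolute convergence -/

section StableKernel

open Complex Set
open scoped Real

/-- The quotient of Gamma functions in the Mellin–Barnes integral for the isotropic stable
density. -/
noncomputable def stableKernel (d : ℕ) (α : ℝ) (s : ℂ) : ℂ :=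
  Complex.Gamma (d / 2 + α / 2 * s) * Complex.Gamma (-s) / Complex.Gamma (-(α / 2 * s))

theorem foxKernel_stable (d : ℕ) (α : ℝ) (s : ℂ) :
    foxKernel 1 1 ![((1 : ℂ), (1 : ℝ))] ![((d / 2 : ℂ), α / 2), ((1 : ℂ), α / 2)] s =
      stableKernel d α s := by
  simp [foxKernel, stableKernel, Finset.prod_filter, Fin.prod_univ_two]

/-- Only the two innermost poles matter: s = -d/α on the left and s = 0 on the right. -/
theorem foxSeparates_stable_iff {d : ℕ} {α : ℝ} (hα : 0 < α) (γ : ℝ) :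
    FoxSeparates 1 1 ![((1 : ℂ), (1 : ℝ))] ![((d / 2 : ℂ), α / 2), ((1 : ℂ), α / 2)] γ ↔
      0 < d + α * γ ∧ γ < 0 := by
  have e : ∀ l : ℕ, ((-(d / 2 : ℂ) - l) / ((α / 2 : ℝ) : ℂ)).re = (-(d / 2) - l) / (α / 2) := by
    intro l
    rw [div_ofReal_re]
    simp
  simp only [FoxSeparates, Fin.forall_fin_two, Fin.forall_fin_one]
  simp only [Fin.isValue, Fin.val_zero, zero_lt_one, forall_const,
    Matrix.cons_val_zero, Fin.val_one, lt_self_iff_false, IsEmpty.forall_iff, and_true, e,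
    sub_self, zero_add]
  constructor
  · rintro ⟨h1, h2⟩
    have h3 := h1 0
    have h4 := h2 0
    rw [div_lt_iff₀ (by positivity)] at h3
    simp at h3 h4
    exact ⟨by linarith, h4⟩
  · rintro ⟨h1, h2⟩
    refine ⟨fun l => ?_, fun k => ?_⟩
    · rw [div_lt_iff₀ (by positivity)]
      have hl : (0 : ℝ) ≤ l := Nat.cast_nonneg l
      linarith
    · have hk : (0 : ℝ) ≤ k := Nat.cast_nonneg k
      simp
      linarith

variable {d : ℕ} {α γ : ℝ}

theorem integrable_stableKernel (hα : 0 < α) (h : 0 < d + α * γ) (hγ : γ < 0) :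
    Integrable fun t : ℝ => stableKernel d α (γ + t * I) := by
  have ha : 0 < (d + α * γ) / 2 := by linarith
  have hc : 0 < -(α * γ) / 2 := by nlinarith
  have hg : 0 < -γ := by linarith
  have e1 : ∀ t : ℝ, (d / 2 + α / 2 * (γ + t * I) : ℂ) =
      (((d + α * γ) / 2 : ℝ) : ℂ) + ((α / 2 : ℝ) : ℂ) * t * I := fun t => by push_cast; ring
  have e2 : ∀ t : ℝ, (-(γ + t * I) : ℂ) = ((-γ : ℝ) : ℂ) + ((-1 : ℝ) : ℂ) * t * I :=
    fun t => by push_cast; ring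
  have e3 : ∀ t : ℝ, (-(α / 2 * (γ + t * I)) : ℂ) =
      ((-(α * γ) / 2 : ℝ) : ℂ) + ((-(α / 2) : ℝ) : ℂ) * t * I := fun t => by push_cast; ring
  obtain ⟨C, hC, N, hN⟩ := norm_Gamma_le_pow_mul_norm_Gamma ha hc
  -- Of the N + 2 powers, N absorb the growth of the Gamma quotient and two leave the integrable
  -- bound 1 / (1 + t²).
  obtain ⟨C', hC', hN'⟩ := one_add_abs_pow_mul_norm_Gamma_le (N + 2) hg
  have hcont : Continuous fun t : ℝ => stableKernel d α (γ + t * I) := by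
    simp only [stableKernel, e1, e2, e3]
    refine ((continuous_Gamma_vertical ha _).mul (continuous_Gamma_vertical hg _)).div
      (continuous_Gamma_vertical hc _) fun t => ?_
    refine Complex.Gamma_ne_zero_of_re_pos ?_
    simpa using hc
  refine ((integrable_inv_one_add_sq).const_mul (C * (1 + α) ^ N * C')).mono
    hcont.aestronglyMeasurable (ae_of_all _ fun t => ?_)
  have hG : 0 < ‖Complex.Gamma (-(α / 2 * (γ + t * I)))‖ := by
    refine norm_pos_iff.2 (Complex.Gamma_ne_zero_of_re_pos ?_)
    rw [e3]
    simpa using hc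
  have h1 : ‖Complex.Gamma (d / 2 + α / 2 * (γ + t * I))‖ ≤
      C * ((1 + α) * (1 + |t|)) ^ N * ‖Complex.Gamma (-(α / 2 * (γ + t * I)))‖ := by
    have h2 := hN (α / 2 * t)
    rw [e1, e3]
    -- Numerator and denominator have opposite imaginary parts; conjugation aligns them.
    have e4 : ‖Complex.Gamma (((-(α * γ) / 2 : ℝ) : ℂ) + ((-(α / 2) : ℝ) : ℂ) * t * I)‖ =
        ‖Complex.Gamma (((-(α * γ) / 2 : ℝ) : ℂ) + ((α / 2 * t : ℝ) : ℂ) * I)‖ := by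
      rw [← norm_Gamma_sub_mul_I]
      congr 2
      push_cast
      ring
    rw [e4]
    rw [ofReal_mul] at h2 ⊢
    refine h2.trans ?_
    have h3 : 1 + |α / 2 * t| ≤ (1 + α) * (1 + |t|) := by
      rw [abs_mul, abs_of_pos (by positivity)]
      have := abs_nonneg t
      nlinarith [mul_nonneg hα.le this]
    gcongr
  have h2 : (1 + |t|) ^ (N + 2) * ‖Complex.Gamma (-(γ + t * I))‖ ≤ C' := by
    have h3 := hN' t
    rw [← norm_Gamma_sub_mul_I] at h3
    rw [e2]
    convert h3 using 4
    push_cast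
    ring
  have h5 : (1 + t ^ 2) ≤ (1 + |t|) ^ 2 := by
    have := abs_nonneg t
    nlinarith [sq_abs t]
  rw [stableKernel, norm_div, norm_mul, div_le_iff₀ hG, norm_mul (C * (1 + α) ^ N * C'),
    Real.norm_of_nonneg (by positivity), Real.norm_of_nonneg (by positivity)]
  have h6 : (1 + |t|) ^ N * ‖Complex.Gamma (-(γ + t * I))‖ ≤ C' * (1 + t ^ 2)⁻¹ := by
    rw [← div_eq_mul_inv, le_div_iff₀ (by positivity)]
    calc (1 + |t|) ^ N * ‖Complex.Gamma (-(γ + t * I))‖ * (1 + t ^ 2)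
        ≤ (1 + |t|) ^ N * ‖Complex.Gamma (-(γ + t * I))‖ * (1 + |t|) ^ 2 := by gcongr
      _ = (1 + |t|) ^ (N + 2) * ‖Complex.Gamma (-(γ + t * I))‖ := by ring
      _ ≤ C' := h2
  calc ‖Complex.Gamma (d / 2 + α / 2 * (γ + t * I))‖ * ‖Complex.Gamma (-(γ + t * I))‖
      ≤ (C * ((1 + α) * (1 + |t|)) ^ N * ‖Complex.Gamma (-(α / 2 * (γ + t * I)))‖) *
        ‖Complex.Gamma (-(γ + t * I))‖ := by gcongr
    _ = C * (1 + α) ^ N * ‖Complex.Gamma (-(α / 2 * (γ + t * I)))‖ *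
        ((1 + |t|) ^ N * ‖Complex.Gamma (-(γ + t * I))‖) := by
      rw [mul_pow]
      ring
    _ ≤ C * (1 + α) ^ N * ‖Complex.Gamma (-(α / 2 * (γ + t * I)))‖ * (C' * (1 + t ^ 2)⁻¹) := by
      gcongr
    _ = _ := by ring

theorem integrable_stableKernel_mul_cpow (hα : 0 < α) (h : 0 < d + α * γ) (hγ : γ < 0) {z : ℝ}
    (hz : 0 < z) :
    Integrable fun t : ℝ => stableKernel d α (γ + t * I) * (z : ℂ) ^ (-(γ + t * I : ℂ)) := by
  have hz' : (z : ℂ) ≠ 0 := ofReal_ne_zero.2 hz.ne'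
  refine (integrable_stableKernel hα h hγ).mul_bdd (c := z ^ (-γ)) ?_ (ae_of_all _ fun t => ?_)
  · refine Continuous.aestronglyMeasurable (Continuous.const_cpow (by fun_prop) (Or.inl hz'))
  · rw [Complex.norm_cpow_eq_rpow_re_of_pos hz]
    simp

end StableKernel

/-! ### Mellin inversion and the H-function -/

section StableDensity

open Complex Set
open scoped Real

theorem ofReal_rpow_cpow {x : ℝ} (hx : 0 < x) (α : ℝ) (s : ℂ) :
    ((x ^ α : ℝ) : ℂ) ^ s = (x : ℂ) ^ (α * s) := by
  rw [cpow_def_of_ne_zero (ofReal_ne_zero.2 (by positivity)),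
    cpow_def_of_ne_zero (ofReal_ne_zero.2 hx.ne'), ← ofReal_log (by positivity),
    ← ofReal_log hx.le, Real.log_rpow hx]
  push_cast
  ring_nf

theorem pi_cpow_mul_two_pi_cpow (n : ℕ) (u : ℂ) :
    (π : ℂ) ^ ((n / 2 : ℂ) - (n + u)) * ((2 * π : ℝ) : ℂ) ^ u =
      ((π ^ (-(n : ℝ) / 2) : ℝ) : ℂ) * ((1 / 2 : ℝ) : ℂ) ^ (-u) := by
  have hπ : (π : ℂ) ≠ 0 := ofReal_ne_zero.2 Real.pi_ne_zero
  rw [cpow_def_of_ne_zero hπ, cpow_def_of_ne_zero (ofReal_ne_zero.2 (by positivity)),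
    cpow_def_of_ne_zero (ofReal_ne_zero.2 (by positivity)), Real.rpow_def_of_pos Real.pi_pos,
    ← ofReal_log Real.pi_pos.le, ← ofReal_log (by positivity), ← ofReal_log (by positivity),
    Real.log_mul two_ne_zero Real.pi_ne_zero, one_div, Real.log_inv, ofReal_exp,
    ← Complex.exp_add, ← Complex.exp_add]
  push_cast
  ring_nf

variable {V : Type*} [NormedAddCommGroup V] [InnerProductSpace ℝ V] [FiniteDimensional ℝ V]
  [MeasurableSpace V] [BorelSpace V] [Nontrivial V]

/-- The substitution w = n + αs maps the strip -n/α < Re s < 0 onto 0 < Re w < n. -/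
theorem hasMellin_fourierDensity_stableKernel {α : ℝ} (hα : 0 < α) {μ : Measure V}
    [IsProbabilityMeasure μ] (hμ : ∀ ξ, charFun μ ξ = (Real.exp (-‖ξ‖ ^ α) : ℂ)) {e : V}
    (he : ‖e‖ = 1) {γ : ℝ} (h : 0 < Module.finrank ℝ V + α * γ) (hγ : γ < 0) (t : ℝ) :
    HasMellin (fun r : ℝ => fourierDensity μ (r • e))
      (Module.finrank ℝ V + α * (γ + t * I))
      (((π ^ (-(Module.finrank ℝ V : ℝ) / 2) : ℝ) : ℂ) * (α : ℂ)⁻¹ *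
        (stableKernel (Module.finrank ℝ V) α (γ + t * I) *
          (((1 / 2) ^ α : ℝ) : ℂ) ^ (-(γ + t * I : ℂ)))) := by
  have hα' : (α : ℂ) ≠ 0 := ofReal_ne_zero.2 hα.ne'
  have hre : (Module.finrank ℝ V + α * (γ + t * I) : ℂ).re = Module.finrank ℝ V + α * γ := by
    simp
  have hM := hasMellin_fourierDensity hα hμ he
    (w := Module.finrank ℝ V + α * (γ + t * I)) (by rw [hre]; exact h)
    (by rw [hre]; nlinarith)
  convert hM using 1
  set n := Module.finrank ℝ V
  set s : ℂ := γ + t * I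
  have e1 : ((n + α * s) / 2 : ℂ) = n / 2 + α / 2 * s := by ring
  have e2 : ((n - (n + α * s)) / α : ℂ) = -s := by field_simp; ring
  have e3 : ((n - (n + α * s)) / 2 : ℂ) = -(α / 2 * s) := by ring
  have e4 : (n + α * s - n : ℂ) = α * s := by ring
  have key := pi_cpow_mul_two_pi_cpow n (α * s)
  rw [e1, e2, e3, e4, ofReal_rpow_cpow (by norm_num), stableKernel, mul_neg]
  linear_combination (-(α : ℂ)⁻¹ * (Gamma (n / 2 + α / 2 * s) * Gamma (-s) /
    Gamma (-(α / 2 * s)))) * key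

/-- The Mellin–Barnes representation of the isotropic stable density. -/
theorem fourierDensity_smul_eq_mellinBarnes {α : ℝ} (hα : 0 < α) {μ : Measure V}
    [IsProbabilityMeasure μ] (hμ : ∀ ξ, charFun μ ξ = (Real.exp (-‖ξ‖ ^ α) : ℂ)) {e : V}
    (he : ‖e‖ = 1) {γ : ℝ} (h : 0 < Module.finrank ℝ V + α * γ) (hγ : γ < 0) {r : ℝ}
    (hr : 0 < r) :
    fourierDensity μ (r • e) =
      ((π ^ (-(Module.finrank ℝ V : ℝ) / 2) * r ^ (-(Module.finrank ℝ V : ℝ)) : ℝ) : ℂ) *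
        (1 / (2 * π) * ∫ t : ℝ, stableKernel (Module.finrank ℝ V) α (γ + t * I) *
          (((r / 2) ^ α : ℝ) : ℂ) ^ (-(γ + t * I : ℂ))) := by
  set n := Module.finrank ℝ V with hn_def
  have hα' : (α : ℂ) ≠ 0 := ofReal_ne_zero.2 hα.ne'
  have hr' : (r : ℂ) ≠ 0 := ofReal_ne_zero.2 hr.ne'
  have hM := hasMellin_fourierDensity_stableKernel hα hμ he h hγ
  rw [← hn_def] at hM
  -- Height y on the w-line is height t = y/α on the s-line; the Jacobian α cancels the factor 1/α
  -- of the Mellin transform.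
  have hline : ∀ y : ℝ, (((n + α * γ : ℝ) : ℂ) + y * I) = n + α * (γ + (y / α : ℝ) * I) := by
    intro y
    push_cast
    field_simp
    ring
  have hval : ∀ y : ℝ, mellin (fun r : ℝ => fourierDensity μ (r • e))
      (((n + α * γ : ℝ) : ℂ) + y * I) = ((π ^ (-(n : ℝ) / 2) : ℝ) : ℂ) * (α : ℂ)⁻¹ *
        (stableKernel n α (γ + (y / α : ℝ) * I) *
          (((1 / 2) ^ α : ℝ) : ℂ) ^ (-(γ + (y / α : ℝ) * I : ℂ))) := fun y => by
    rw [hline y, (hM (y / α)).2]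
  have hconv : MellinConvergent (fun r : ℝ => fourierDensity μ (r • e)) ((n + α * γ : ℝ) : ℂ) := by
    have := (hM 0).1
    rwa [show (n + α * (γ + (0 : ℝ) * I) : ℂ) = ((n + α * γ : ℝ) : ℂ) by push_cast; ring] at this
  have hvert : VerticalIntegrable (mellin fun r : ℝ => fourierDensity μ (r • e)) (n + α * γ) := by
    have := ((integrable_stableKernel_mul_cpow hα h hγ (z := (1 / 2) ^ α)
      (by positivity)).comp_div hα.ne').const_mul (((π ^ (-(n : ℝ) / 2) : ℝ) : ℂ) * (α : ℂ)⁻¹)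
    exact this.congr (ae_of_all _ fun y => (hval y).symm)
  have hcont : Continuous fun r : ℝ => fourierDensity μ (r • e) :=
    (continuous_fourierDensity (integrable_of_charFun_eq_exp_neg_norm_rpow hα hμ)).comp
      (by fun_prop)
  have hinv := mellinInv_mellin_eq (n + α * γ) _ hr hconv hvert hcont.continuousAt
  rw [← hinv, mellinInv]
  have hint : ∀ y : ℝ, (r : ℂ) ^ (-(((n + α * γ : ℝ) : ℂ) + y * I)) •
      mellin (fun r : ℝ => fourierDensity μ (r • e)) (((n + α * γ : ℝ) : ℂ) + y * I) =
      ((π ^ (-(n : ℝ) / 2) * r ^ (-(n : ℝ)) : ℝ) : ℂ) * (α : ℂ)⁻¹ *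
        (fun t : ℝ => stableKernel n α (γ + t * I) *
          (((r / 2) ^ α : ℝ) : ℂ) ^ (-(γ + t * I : ℂ))) (y / α) := by
    intro y
    rw [hval, hline]
    simp only [smul_eq_mul]
    set s : ℂ := γ + (y / α : ℝ) * I
    rw [ofReal_rpow_cpow (by norm_num), ofReal_rpow_cpow (by positivity), div_eq_mul_one_div r,
      ofReal_mul r, mul_cpow_ofReal_nonneg hr.le (by norm_num), neg_add, cpow_add _ _ hr',
      ofReal_mul, ofReal_cpow hr.le, mul_neg]
    push_cast
    ring
  have hsub := Measure.integral_comp_div (fun t : ℝ => stableKernel n α (γ + t * I) *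
    (((r / 2) ^ α : ℝ) : ℂ) ^ (-(γ + t * I : ℂ))) α
  rw [integral_congr_ae (ae_of_all _ hint), integral_const_mul, hsub, abs_of_pos hα, real_smul,
    real_smul]
  generalize (∫ t : ℝ, stableKernel n α (γ + t * I) *
    (((r / 2) ^ α : ℝ) : ℂ) ^ (-(γ + t * I : ℂ))) = J
  push_cast
  field_simp

theorem hasFoxH_fourierDensity {α : ℝ} (hα : 0 < α) {μ : Measure V}
    [IsProbabilityMeasure μ] (hμ : ∀ ξ, charFun μ ξ = (Real.exp (-‖ξ‖ ^ α) : ℂ)) {x : V}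
    (hx : x ≠ 0) :
    ∃ h : ℂ, HasFoxH 1 1 ![((1 : ℂ), (1 : ℝ))]
        ![((Module.finrank ℝ V / 2 : ℂ), α / 2), ((1 : ℂ), α / 2)]
        (((‖x‖ / 2) ^ α : ℝ) : ℂ) h ∧
      fourierDensity μ x = ((π ^ (-(Module.finrank ℝ V : ℝ) / 2) *
        ‖x‖ ^ (-(Module.finrank ℝ V : ℝ)) : ℝ) : ℂ) * h := by
  set n := Module.finrank ℝ V with hn_def
  have hn : (0 : ℝ) < n := Nat.cast_pos.2 Module.finrank_pos
  have hx' : 0 < ‖x‖ := norm_pos_iff.2 hx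
  have he : ‖‖x‖⁻¹ • x‖ = 1 := norm_smul_inv_norm hx
  have hxe : fourierDensity μ x = fourierDensity μ (‖x‖ • (‖x‖⁻¹ • x)) := by
    rw [smul_inv_smul₀ hx'.ne']
  have hc : (((π ^ (-(n : ℝ) / 2) * ‖x‖ ^ (-(n : ℝ)) : ℝ) : ℂ)) ≠ 0 :=
    ofReal_ne_zero.2 (by positivity)
  -- Defining the value through the density makes it independent of γ. The witness -n/(2α) is the
  -- midpoint of the admissible interval.
  refine ⟨fourierDensity μ x / ((π ^ (-(n : ℝ) / 2) * ‖x‖ ^ (-(n : ℝ)) : ℝ) : ℂ),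
    ⟨⟨by norm_num, le_rfl, ?_, ?_⟩, ⟨-n / (2 * α), ?_⟩, fun γ hγ => ?_⟩, ?_⟩
  · simp
  · simp [Fin.forall_fin_two, hα]
  · rw [foxSeparates_stable_iff hα]
    constructor
    · field_simp
      linarith
    · rw [div_neg_iff]
      exact Or.inr ⟨by linarith, by positivity⟩
  · rw [foxSeparates_stable_iff hα] at hγ
    have e : foxIntegrand 1 1 ![((1 : ℂ), (1 : ℝ))] ![((n / 2 : ℂ), α / 2), ((1 : ℂ), α / 2)] γ
        (((‖x‖ / 2) ^ α : ℝ) : ℂ) = fun t : ℝ => stableKernel n α (γ + t * I) *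
          (((‖x‖ / 2) ^ α : ℝ) : ℂ) ^ (-(γ + t * I : ℂ)) := by
      ext t
      rw [foxIntegrand, foxKernel_stable]
    rw [e]
    refine ⟨integrable_stableKernel_mul_cpow hα hγ.1 hγ.2 (by positivity), ?_⟩
    rw [hxe, fourierDensity_smul_eq_mellinBarnes hα hμ he hγ.1 hγ.2 hx', ← hn_def,
      mul_div_cancel_left₀ _ hc, integral_mul_const]
    have hπ : (π : ℂ) ≠ 0 := ofReal_ne_zero.2 Real.pi_ne_zero
    generalize (∫ t : ℝ, stableKernel n α (γ + t * I) *
      (((‖x‖ / 2) ^ α : ℝ) : ℂ) ^ (-(γ + t * I : ℂ))) = J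
    field_simp
  · rw [mul_div_cancel₀ _ hc]

end StableDensity

theorem theoremT (d : ℕ) (hd : 1 ≤ d) (α : ℝ) (hα : 0 < α) (hα2 : α ≤ 2)
    (μ : Measure (EuclideanSpace ℝ (Fin d))) [IsProbabilityMeasure μ] :
    ((SphericallySymmetric μ ∧ IsStableLaw α μ) ↔
      ∃ σ : ℝ, 0 < σ ∧ ∀ ξ, charFun μ ξ = (Real.exp (-(σ * ‖ξ‖) ^ α) : ℂ)) ∧
    ((∀ ξ, charFun μ ξ = (Real.exp (-‖ξ‖ ^ α) : ℂ)) →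
      ∃ ρ : EuclideanSpace ℝ (Fin d) → ℝ,
        Continuous ρ ∧ (∀ x, 0 ≤ ρ x) ∧
        μ = volume.withDensity (fun x => ENNReal.ofReal (ρ x)) ∧
        ∀ x, x ≠ 0 → ∃ h : ℂ,
          HasFoxH 1 1 ![((1 : ℂ), (1 : ℝ))]
            ![((d / 2 : ℂ), α / 2), ((1 : ℂ), α / 2)] (((‖x‖ / 2) ^ α : ℝ) : ℂ) h ∧
          (ρ x : ℂ) = ((Real.pi ^ (-(d : ℝ) / 2) * ‖x‖ ^ (-(d : ℝ)) : ℝ) : ℂ) * h) := by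
  have : Nontrivial (EuclideanSpace ℝ (Fin d)) :=
    Module.nontrivial_of_finrank_pos (R := ℝ) (by rw [finrank_euclideanSpace_fin]; omega)
  refine ⟨sphericallySymmetric_and_isStableLaw_iff hα μ, fun hμ => ?_⟩
  have hi := integrable_of_charFun_eq_exp_neg_norm_rpow hα hμ
  refine ⟨fun x => (fourierDensity μ x).re,
    Complex.continuous_re.comp (continuous_fourierDensity hi),
    fun x => (fourierDensity_nonneg hi x).1, eq_withDensity_fourierDensity hi, fun x hx => ?_⟩
  have h := hasFoxH_fourierDensity hα hμ hx
  rw [finrank_euclideanSpace_fin, fourierDensity_eq_ofReal_re hi] at h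
  exact h
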